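/- **Setting.** Let $\Phi=B_n$ or $D_n$. The complete signed graph $\mathcal K_\Phi$ on $[n]$ has, for each pair $i>j$, a negative edge with vector $\mathbf e_i-\mathbf e_j$ (a competitive game) and a positive edge with vector $\mathbf e_i+\mathbf e_j$ (a collaborative game); if $\Phi=B_n$, it also has, for each $i$, a half edge with vector $\mathbf e_i$ (a solitaire game). A Coxeter tournament is a choice $\mathcal T=(w_e)$ of $w_e\in\{0,1\}$ for every edge $e$. A collaborative or solitaire game $e$ is *won* if $w_e=1$ and *lost* if $w_e=0$; in the competitive game between $i>j$, player $i$ *beats* $j$ if $w_e=1$, and $j$ beats $i$ if $w_e=0$. The score sequence of $\mathcal T$ is $\mathbf s(\mathcal T)=\sum_e(w_e-\tfrac12)\,\mathbf e$, where $\mathbf e\in\mathbb R^n$ is the vector of $e$. Let $\mathrm{Score}(\Phi)$ be the set of all score sequences, and $\mathrm{Tour}(\Phi,\mathbf s)$ the set of Coxeter tournaments with score sequence $\mathbf s$. A generator in $\mathcal T$ is a set of three games of one of the following forms, with $i,j,k$ distinct: the competitive games between $i,j$, between $j,k$ and between $k,i$, where $i$ beats $j$, $j$ beats $k$ and $k$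 beats $i$ (cyclic triangle); the competitive game between $i,j$, in which $i$ beats $j$, a won collaborative game of $j,k$ and a lost collaborative game of $k,i$ (balanced triangle); and, if $\Phi=B_n$, the solitaire games of $i$ and $j$ together with (a) their collaborative game, lost, both solitaire games being won, or (b) their collaborative game, won, both solitaire games being lost, or (c) their competitive game, in which $i$ beats $j$, the solitaire game of $i$ being lost and that of $j$ won (neutral pairs). The interchange graph $\mathrm{IntGr}(\Phi,\mathbf s)$ has vertex set $\mathrm{Tour}(\Phi,\mathbf s)$, and two vertices are adjacent if one is obtained from the other by reversing all outcomes in a generator. Lazy simple random walk on a finite graph stays put with probability $1/2$ and otherwise moves to a uniformly random neighbour (at an isolated vertex it always stays put). If the $t$-step transition probabilities $p_t(x,y)$ converge to a limit $\pi(y)$ for all states $x,y$, then $\pi$ is the equilibrium, and the mixing time is $t_{\rm mix}=\inf\{t\ge0:\max_x\frac12\sum_y|p_t(x,y)-\pi(y)|\le\frac14\}$. **Theorem 6.1.** There is an absolute constant $C>0$ such that, for every $n$, for $\Phi=B_n$ or $D_n$, and for every $\mathbf s\in\mathrm{Score}(\Phi)$, the graph $\mathrm{IntGr}(\Phi,\mathbf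 s)$ is regular, of some degree $d$, and lazy simple random walk on it has an equilibrium and a finite mixing time satisfying $$t_{\rm mix}\le C\,d\log n .$$ -/

import Mathlib

open Filter Topology

/-- The two types of root systems considered: `B_n` and `D_n`. -/
inductive CoxeterType
  | B
  | D
  deriving DecidableEq

/-- The edges of the complete signed graph of type `Φ` on the players `Fin n`. Between any two
distinct players there is one negative and one positive edge (each unordered pair is listed once,
with its larger element first); in type `B` every player also has a half edge. -/
inductive SignedEdge (Φ : CoxeterType) (n : ℕ)
  | neg (i j : Fin n) (h : j < i)
  | pos (i j : Fin n) (h : j < i)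
  | half (hΦ : Φ = CoxeterType.B) (i : Fin n)
  deriving DecidableEq, Fintype

namespace SignedEdge

variable {Φ : CoxeterType} {n : ℕ}

/-- The vector of a signed edge: `e_i - e_j`, `e_i + e_j` or `e_i`. -/
def vec : SignedEdge Φ n → (Fin n → ℝ)
  | neg i j _ => Pi.single i 1 - Pi.single j 1
  | pos i j _ => Pi.single i 1 + Pi.single j 1
  | half _ i => Pi.single i 1

/-- The negative edge between two distinct players, in either order. -/
def between (i j : Fin n) (h : i ≠ j) : SignedEdge Φ n :=
  if h' : j < i then neg i j h' else neg j i (lt_of_le_of_ne (not_lt.mp h') h)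

/-- The positive edge between two distinct players, in either order. -/
def joining (i j : Fin n) (h : i ≠ j) : SignedEdge Φ n :=
  if h' : j < i then pos i j h' else pos j i (lt_of_le_of_ne (not_lt.mp h') h)

end SignedEdge

/-- A Coxeter tournament on the complete signed graph of type `Φ`: an outcome
(`true` for `w_e = 1`, `false` for `w_e = 0`) of every game `e`. -/
abbrev CoxeterTournament (Φ : CoxeterType) (n : ℕ) : Type := SignedEdge Φ n → Bool

namespace CoxeterTournament

variable {Φ : CoxeterType} {n : ℕ}

/-- The score sequence `∑ₑ (w_e - 1/2) e`. -/
noncomputable def score (T : CoxeterTournament Φ n) : Fin n → ℝ :=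
  ∑ e : SignedEdge Φ n, ((if T e then (1 : ℝ) else 0) - 1 / 2) • e.vec

/-- Reversing the outcomes of exactly the games in `S`. -/
def reverse (T : CoxeterTournament Φ n) (S : Finset (SignedEdge Φ n)) : CoxeterTournament Φ n :=
  fun e => if e ∈ S then !(T e) else T e

/-- The competitive game between `i` and `j` is won by `i`, that is, it contributes
`(e_i - e_j)/2` to the score. -/
def Beats (T : CoxeterTournament Φ n) (i j : Fin n) (h : i ≠ j) : Prop :=
  T (SignedEdge.between i j h) = decide (j < i)

/-- The collaborative game of `i` and `j` is won. -/
def CollabWon (T : CoxeterTournament Φ n) (i j : Fin n) (h : i ≠ j) : Prop :=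
  T (SignedEdge.joining i j h) = true

/-- The collaborative game of `i` and `j` is lost. -/
def CollabLost (T : CoxeterTournament Φ n) (i j : Fin n) (h : i ≠ j) : Prop :=
  T (SignedEdge.joining i j h) = false

/-- `T.IsGenerator S`: the games in `S`, with their outcomes in `T`, form a copy of one of the
generators of type `Φ`: a cyclic triangle, a balanced triangle or, in type `B` only, one of the
three neutral pairs. -/
inductive IsGenerator (T : CoxeterTournament Φ n) : Finset (SignedEdge Φ n) → Prop
  | cyclicTriangle (i j k : Fin n) (hij : i ≠ j) (hjk : j ≠ k) (hki : k ≠ i)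
      (h₁ : T.Beats i j hij) (h₂ : T.Beats j k hjk) (h₃ : T.Beats k i hki) :
      IsGenerator T {SignedEdge.between i j hij, SignedEdge.between j k hjk,
        SignedEdge.between k i hki}
  | balancedTriangle (i j k : Fin n) (hij : i ≠ j) (hjk : j ≠ k) (hki : k ≠ i)
      (h₁ : T.Beats i j hij) (h₂ : T.CollabWon j k hjk) (h₃ : T.CollabLost k i hki) :
      IsGenerator T {SignedEdge.between i j hij, SignedEdge.joining j k hjk,
        SignedEdge.joining k i hki}
  | neutralPairOne (hΦ : Φ = CoxeterType.B) (i j : Fin n) (hij : i ≠ j)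
      (h₁ : T (SignedEdge.half hΦ i) = true) (h₂ : T (SignedEdge.half hΦ j) = true)
      (h₃ : T.CollabLost i j hij) :
      IsGenerator T {SignedEdge.half hΦ i, SignedEdge.half hΦ j, SignedEdge.joining i j hij}
  | neutralPairTwo (hΦ : Φ = CoxeterType.B) (i j : Fin n) (hij : i ≠ j)
      (h₁ : T (SignedEdge.half hΦ i) = false) (h₂ : T (SignedEdge.half hΦ j) = false)
      (h₃ : T.CollabWon i j hij) :
      IsGenerator T {SignedEdge.half hΦ i, SignedEdge.half hΦ j, SignedEdge.joining i j hij}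
  | neutralPairThree (hΦ : Φ = CoxeterType.B) (i j : Fin n) (hij : i ≠ j)
      (h₁ : T (SignedEdge.half hΦ i) = false) (h₂ : T (SignedEdge.half hΦ j) = true)
      (h₃ : T.Beats i j hij) :
      IsGenerator T {SignedEdge.half hΦ i, SignedEdge.half hΦ j, SignedEdge.between i j hij}

theorem reverse_reverse (T : CoxeterTournament Φ n) (S : Finset (SignedEdge Φ n)) :
    (T.reverse S).reverse S = T := by
  funext e
  by_cases h : e ∈ S <;> simp [reverse, h]

theorem reverse_apply_mem (T : CoxeterTournament Φ n) {S : Finset (SignedEdge Φ n)}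
    {e : SignedEdge Φ n} (h : e ∈ S) : T.reverse S e = !(T e) := by
  simp [reverse, h]

theorem between_symm (i j : Fin n) (h : i ≠ j) :
    (SignedEdge.between i j h : SignedEdge Φ n) = SignedEdge.between j i h.symm := by
  rcases lt_or_gt_of_ne h with h' | h' <;>
    simp [SignedEdge.between, h', not_lt_of_gt h']

theorem joining_symm (i j : Fin n) (h : i ≠ j) :
    (SignedEdge.joining i j h : SignedEdge Φ n) = SignedEdge.joining j i h.symm := by
  rcases lt_or_gt_of_ne h with h' | h' <;>
    simp [SignedEdge.joining, h', not_lt_of_gt h']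

theorem beats_reverse {T : CoxeterTournament Φ n} {S : Finset (SignedEdge Φ n)} {i j : Fin n}
    {h : i ≠ j} (hT : T.Beats i j h) (hS : SignedEdge.between i j h ∈ S) :
    (T.reverse S).Beats j i h.symm := by
  unfold Beats at *
  rw [between_symm j i, reverse_apply_mem T hS, hT]
  rcases lt_or_gt_of_ne h with h' | h' <;> simp [h', not_lt_of_gt h']

/-- The reversal of a generator is again a generator. -/
theorem IsGenerator.reverse {T : CoxeterTournament Φ n} {S : Finset (SignedEdge Φ n)}
    (h : T.IsGenerator S) : (T.reverse S).IsGenerator S := by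
  cases h with
  | cyclicTriangle i j k hij hjk hki h₁ h₂ h₃ =>
    have := IsGenerator.cyclicTriangle (T := T.reverse {SignedEdge.between i j hij,
        SignedEdge.between j k hjk, SignedEdge.between k i hki}) j i k hij.symm hki.symm hjk.symm
        (beats_reverse h₁ (by simp)) (beats_reverse h₃ (by simp)) (beats_reverse h₂ (by simp))
    convert this using 1
    rw [between_symm j i, between_symm i k, between_symm k j]
    ext e; simp; tauto
  | balancedTriangle i j k hij hjk hki h₁ h₂ h₃ =>
    have := IsGenerator.balancedTriangle (T := T.reverse {SignedEdge.between i j hij,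
        SignedEdge.joining j k hjk, SignedEdge.joining k i hki}) j i k hij.symm hki.symm hjk.symm
        (beats_reverse h₁ (by simp))
        (by unfold CollabWon CollabLost at *
            rw [joining_symm i k, reverse_apply_mem _ (by simp), h₃]; rfl)
        (by unfold CollabWon CollabLost at *
            rw [joining_symm k j, reverse_apply_mem _ (by simp), h₂]; rfl)
    convert this using 1
    rw [between_symm j i, joining_symm i k, joining_symm k j]
    ext e; simp; tauto
  | neutralPairOne hΦ i j hij h₁ h₂ h₃ =>
    unfold CollabLost at h₃
    exact IsGenerator.neutralPairTwo hΦ i j hij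
      (by rw [reverse_apply_mem _ (by simp), h₁]; rfl)
      (by rw [reverse_apply_mem _ (by simp), h₂]; rfl)
      (by unfold CollabWon; rw [reverse_apply_mem _ (by simp), h₃]; rfl)
  | neutralPairTwo hΦ i j hij h₁ h₂ h₃ =>
    unfold CollabWon at h₃
    exact IsGenerator.neutralPairOne hΦ i j hij
      (by rw [reverse_apply_mem _ (by simp), h₁]; rfl)
      (by rw [reverse_apply_mem _ (by simp), h₂]; rfl)
      (by unfold CollabLost; rw [reverse_apply_mem _ (by simp), h₃]; rfl)
  | neutralPairThree hΦ i j hij h₁ h₂ h₃ =>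
    have := IsGenerator.neutralPairThree (T := T.reverse {SignedEdge.half hΦ i,
        SignedEdge.half hΦ j, SignedEdge.between i j hij}) hΦ j i hij.symm
      (by rw [reverse_apply_mem _ (by simp), h₂]; rfl)
      (by rw [reverse_apply_mem _ (by simp), h₁]; rfl)
      (beats_reverse h₃ (by simp))
    convert this using 1
    rw [between_symm j i]
    ext e; simp; tauto

theorem IsGenerator.reverse_ne {T : CoxeterTournament Φ n} {S : Finset (SignedEdge Φ n)}
    (h : T.IsGenerator S) : T.reverse S ≠ T := by
  have hne : S.Nonempty := by cases h <;> simp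
  obtain ⟨e, he⟩ := hne
  intro hT
  have := congrFun hT e
  rw [reverse_apply_mem T he] at this
  cases hTe : T e <;> simp [hTe] at this

end CoxeterTournament

/-- `Score(Φ)`: the set of all score sequences of Coxeter tournaments of type `Φ` on `n` players. -/
def ScoreSet (Φ : CoxeterType) (n : ℕ) : Set (Fin n → ℝ) :=
  Set.range (CoxeterTournament.score (Φ := Φ))

/-- `Tour(Φ, s)`: the Coxeter tournaments of type `Φ` with score sequence `s`. -/
def Tour (Φ : CoxeterType) {n : ℕ} (s : Fin n → ℝ) : Type :=
  {T : CoxeterTournament Φ n // T.score = s}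

noncomputable instance (Φ : CoxeterType) {n : ℕ} (s : Fin n → ℝ) : Fintype (Tour Φ s) :=
  Fintype.ofInjective (fun T : Tour Φ s => T.1) Subtype.val_injective

noncomputable instance (Φ : CoxeterType) {n : ℕ} (s : Fin n → ℝ) : DecidableEq (Tour Φ s) :=
  Classical.decEq _

/-- The Coxeter interchange graph. In types `B` and `D` it is a simple graph: the reversed generator
is the set of games in which two neighbours differ, and there are no clovers. -/
def IntGr (Φ : CoxeterType) {n : ℕ} (s : Fin n → ℝ) : SimpleGraph (Tour Φ s) where
  Adj T₁ T₂ := ∃ S : Finset (SignedEdge Φ n), T₁.1.IsGenerator S ∧ T₂.1 = T₁.1.reverse S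
  symm := ⟨by
    rintro T₁ T₂ ⟨S, hS, h⟩
    refine ⟨S, ?_, ?_⟩
    · rw [h]; exact hS.reverse
    · rw [h, CoxeterTournament.reverse_reverse]⟩
  loopless := ⟨by
    rintro T ⟨S, hS, h⟩
    exact hS.reverse_ne h.symm⟩

noncomputable instance (Φ : CoxeterType) {n : ℕ} (s : Fin n → ℝ) :
    DecidableRel (IntGr Φ s).Adj :=
  Classical.decRel _

section MarkovChains

variable {V : Type*} [Fintype V] [DecidableEq V]

/-- Transition matrix of simple random walk on a finite graph: from `x`, move to a uniformly random
neighbour of `x` (and stay put if `x` is isolated). -/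
noncomputable def simpleWalk (G : SimpleGraph V) [DecidableRel G.Adj] : Matrix V V ℝ :=
  Matrix.of fun x y =>
    if G.degree x = 0 then (if x = y then 1 else 0)
    else if G.Adj x y then 1 / (G.degree x : ℝ) else 0

/-- Transition matrix of lazy simple random walk: with probability `1/2` stay put, and otherwise
make a step of simple random walk. -/
noncomputable def lazyWalk (G : SimpleGraph V) [DecidableRel G.Adj] : Matrix V V ℝ :=
  (1 / 2 : ℝ) • (1 + simpleWalk G)

/-- `π` is the equilibrium of the Markov chain with transition matrix `P`: for all `x` and `y`, the
`t`-step transition probabilities `p_t(x, y)` converge to `π y`. -/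
def IsEquilibrium (P : Matrix V V ℝ) (π : V → ℝ) : Prop :=
  ∀ x y : V, Tendsto (fun t : ℕ => (P ^ t) x y) atTop (𝓝 (π y))

/-- The maximal total variation distance from `π` at time `t`. -/
noncomputable def maxTVDist (P : Matrix V V ℝ) (π : V → ℝ) (t : ℕ) : ℝ :=
  ⨆ x : V, (1 / 2 : ℝ) * ∑ y : V, |(P ^ t) x y - π y|

/-- The mixing time: the first time at which the maximal total variation distance from `π` is at
most `1/4` (`⊤` if there is no such time). -/
noncomputable def mixingTime (P : Matrix V V ℝ) (π : V → ℝ) : ℕ∞ :=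
  ⨅ (t : ℕ) (_ : maxTVDist P π t ≤ 1 / 4), (t : ℕ∞)

end MarkovChains

/-! Record a tournament by the set `H` of signed edge vectors that its games contribute: one root
out of each pair of opposite roots. The score is half the sum of `H`, and a generator is exactly a
triple of roots in `H` with sum zero, so a step in the interchange graph replaces such a triple by
its negatives. The combinatorics then takes place among integer vectors of squared length 2 (and
also 1 in type B).

Mixing follows from a contraction, the dual form of path coupling. Suppose that, for adjacent x and
y, the other neighbours of x are matched along edges with the other neighbours of y
(`HasNeighborMatching`). Then degrees agree, and one lazy step shrinks the Lipschitz constant of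
every function by the factor 1 - 1/d. If the diameter is at most D, the distance from the uniform
distribution after t steps is at most D(1 - 1/d)^t, so time about d log(4D) suffices.

The matching comes from four-cycles (`FlipMatch`). Disjoint zero triples can be flipped in either
order. Different zero triples {α, β, γ} and {α, δ, ε} that meet share one root only, and by
`IsRoot.add_iff_not_add` exactly one of δ - β and δ - γ is a root. After relabelling, ρ = δ - β lies
in `H`, and flipping {-γ, ε, ρ} after the first triple has the same effect as flipping {β, -δ, ρ}
after the second. That only one of the two differences is a root also makes the matching injective.

For the diameter, the roots in which two tournaments with equal score differ have sum zero. By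
`multiset_sum_ne_zero` they are not closed under addition of roots, which yields a flip bringing the
tournaments closer (`IsHalfSystem.exists_closer`). So D is at most the number of games, hence at
most 3n², and log(4D) is of order log n. -/

/-! ### Contraction of Lipschitz functions under the lazy walk -/

section LipschitzContraction

open Finset

variable {V : Type*} [Fintype V] [DecidableEq V] (G : SimpleGraph V) [DecidableRel G.Adj]

/-- For adjacent `x` and `y`, the other neighbours of `x` are matched injectively with other
neighbours of `y`, each one with a vertex adjacent to it. -/
def HasNeighborMatching : Prop :=
  ∀ x y, G.Adj x y → ∃ f : V → V, Set.InjOn f {z | G.Adj x z ∧ z ≠ y} ∧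
    ∀ z, G.Adj x z → z ≠ y → G.Adj y (f z) ∧ f z ≠ x ∧ G.Adj z (f z)

variable {G}

theorem HasNeighborMatching.degree_le (hM : HasNeighborMatching G) {x y : V} (h : G.Adj x y) :
    G.degree x ≤ G.degree y := by
  obtain ⟨f, hinj, hf⟩ := hM x y h
  have h1 : #((G.neighborFinset x).erase y) ≤ #((G.neighborFinset y).erase x) := by
    apply Finset.card_le_card_of_injOn f
    · intro z hz
      simp only [coe_erase, SimpleGraph.coe_neighborFinset, Set.mem_sdiff,
        SimpleGraph.mem_neighborSet, Set.mem_singleton_iff] at hz ⊢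
      exact ⟨(hf z hz.1 hz.2).1, (hf z hz.1 hz.2).2.1⟩
    · intro z hz z' hz' hzz
      simp only [coe_erase, SimpleGraph.coe_neighborFinset, Set.mem_sdiff,
        SimpleGraph.mem_neighborSet, Set.mem_singleton_iff] at hz hz'
      exact hinj hz hz' hzz
  rw [card_erase_of_mem (by simpa using h), card_erase_of_mem (by simpa using h.symm),
    SimpleGraph.card_neighborFinset_eq_degree, SimpleGraph.card_neighborFinset_eq_degree] at h1
  have : 0 < G.degree y := (G.degree_pos_iff_exists_adj y).2 ⟨x, h.symm⟩
  omega

theorem HasNeighborMatching.degree_eq (hM : HasNeighborMatching G) {x y : V} (h : G.Adj x y) :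
    G.degree x = G.degree y :=
  le_antisymm (hM.degree_le h) (hM.degree_le h.symm)

theorem HasNeighborMatching.isRegularOfDegree (hM : HasNeighborMatching G)
    (hG : G.Preconnected) (x₀ : V) : G.IsRegularOfDegree (G.degree x₀) := by
  intro x
  obtain ⟨w⟩ := hG x x₀
  induction w with
  | nil => rfl
  | cons h _ ih => rw [hM.degree_eq h, ih]

theorem HasNeighborMatching.abs_sum_sub_sum_le (hM : HasNeighborMatching G) {d : ℕ}
    (hd : G.IsRegularOfDegree d) {g : V → ℝ} {K : ℝ}
    (hg : ∀ x y, G.Adj x y → |g x - g y| ≤ K) {x y : V} (h : G.Adj x y) :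
    |∑ z ∈ (G.neighborFinset x).erase y, g z - ∑ z ∈ (G.neighborFinset y).erase x, g z|
      ≤ ((d : ℝ) - 1) * K := by
  obtain ⟨f, hinj, hf⟩ := hM x y h
  have hmem : ∀ z ∈ (G.neighborFinset x).erase y, G.Adj x z ∧ z ≠ y := by
    intro z hz
    simpa [and_comm] using hz
  have hcx : #((G.neighborFinset x).erase y) = d - 1 := by
    rw [card_erase_of_mem (by simpa using h), SimpleGraph.card_neighborFinset_eq_degree, hd x]
  have hcy : #((G.neighborFinset y).erase x) = d - 1 := by
    rw [card_erase_of_mem (by simpa using h.symm), SimpleGraph.card_neighborFinset_eq_degree,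
      hd y]
  have hinj' : Set.InjOn f ((G.neighborFinset x).erase y : Finset V) := by
    intro z hz z' hz' hzz
    exact hinj (hmem z hz) (hmem z' hz') hzz
  -- Both sides have d - 1 elements, so the injective matching is also onto.
  have himg : ((G.neighborFinset x).erase y).image f = (G.neighborFinset y).erase x := by
    apply Finset.eq_of_subset_of_card_le
    · intro w hw
      obtain ⟨z, hz, rfl⟩ := Finset.mem_image.1 hw
      have := hf z (hmem z hz).1 (hmem z hz).2
      simp [this.1, this.2.1]
    · rw [Finset.card_image_of_injOn hinj', hcx, hcy]
  have hdpos : 1 ≤ d := by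
    rw [← hd x]; exact (G.degree_pos_iff_exists_adj x).2 ⟨y, h⟩
  rw [← himg, Finset.sum_image hinj', ← Finset.sum_sub_distrib]
  calc _ ≤ ∑ z ∈ (G.neighborFinset x).erase y, |g z - g (f z)| := Finset.abs_sum_le_sum_abs _ _
    _ ≤ ∑ z ∈ (G.neighborFinset x).erase y, K := by
        apply Finset.sum_le_sum
        intro z hz
        exact hg _ _ (hf z (hmem z hz).1 (hmem z hz).2).2.2
    _ = _ := by
        rw [Finset.sum_const, hcx, nsmul_eq_mul, Nat.cast_sub hdpos, Nat.cast_one]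

theorem lazyWalk_mulVec {d : ℕ} (hd : G.IsRegularOfDegree d) (hd0 : d ≠ 0) (g : V → ℝ) (x : V) :
    (lazyWalk G).mulVec g x = 1 / 2 * g x + 1 / (2 * d) * ∑ z ∈ G.neighborFinset x, g z := by
  have hx : ∀ z, simpleWalk G x z * g z = if G.Adj x z then 1 / (d : ℝ) * g z else 0 := by
    intro z
    simp only [simpleWalk, Matrix.of_apply, hd x, hd0, if_false, ite_mul, zero_mul]
  have : (simpleWalk G).mulVec g x = 1 / d * ∑ z ∈ G.neighborFinset x, g z := by
    simp only [Matrix.mulVec, dotProduct, hx]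
    rw [← Finset.sum_filter, Finset.mul_sum]
    congr 1
    ext z; simp
  rw [lazyWalk, Matrix.smul_mulVec, Pi.smul_apply, Matrix.add_mulVec, Pi.add_apply,
    Matrix.one_mulVec, this, smul_eq_mul]
  ring

theorem HasNeighborMatching.abs_lazyWalk_sub_le (hM : HasNeighborMatching G) {d : ℕ}
    (hd : G.IsRegularOfDegree d) {g : V → ℝ} {K : ℝ}
    (hg : ∀ x y, G.Adj x y → |g x - g y| ≤ K) {x y : V} (h : G.Adj x y) :
    |(lazyWalk G).mulVec g x - (lazyWalk G).mulVec g y| ≤ (1 - 1 / (d : ℝ)) * K := by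
  have hdpos : 1 ≤ d := by
    rw [← hd x]; exact (G.degree_pos_iff_exists_adj x).2 ⟨y, h⟩
  have hd1 : (1 : ℝ) ≤ d := by exact_mod_cast hdpos
  have hd0 : (0 : ℝ) < d := by linarith
  rw [lazyWalk_mulVec hd (by omega), lazyWalk_mulVec hd (by omega),
    ← Finset.add_sum_erase (G.neighborFinset x) g (a := y) (by simpa using h),
    ← Finset.add_sum_erase (G.neighborFinset y) g (a := x) (by simpa using h.symm)]
  have h1 := hM.abs_sum_sub_sum_le hd hg h
  have h2 := hg x y h
  set A := ∑ z ∈ (G.neighborFinset x).erase y, g z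
  set B := ∑ z ∈ (G.neighborFinset y).erase x, g z
  -- The edge between x and y enters the two neighbour sums with opposite sign, which is where the
  -- gain arises: the total weight is (1/2 - 1/(2d)) + (d - 1)/(2d) = 1 - 1/d.
  have e : 1 / 2 * g x + 1 / (2 * (d : ℝ)) * (g y + A) -
      (1 / 2 * g y + 1 / (2 * (d : ℝ)) * (g x + B)) =
      (1 / 2 - 1 / (2 * d)) * (g x - g y) + 1 / (2 * d) * (A - B) := by ring
  have hc : (0 : ℝ) ≤ 1 / 2 - 1 / (2 * d) := by
    rw [sub_nonneg]
    exact one_div_le_one_div_of_le (by norm_num) (by linarith)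
  rw [e]
  calc _ ≤ |(1 / 2 - 1 / (2 * (d : ℝ))) * (g x - g y)| + |1 / (2 * (d : ℝ)) * (A - B)| :=
        abs_add_le _ _
    _ = (1 / 2 - 1 / (2 * (d : ℝ))) * |g x - g y| + 1 / (2 * (d : ℝ)) * |A - B| := by
        rw [abs_mul, abs_mul, abs_of_nonneg hc, abs_of_nonneg (by positivity : 0 ≤ 1 / (2 * (d : ℝ)))]
    _ ≤ (1 / 2 - 1 / (2 * (d : ℝ))) * K + 1 / (2 * (d : ℝ)) * (((d : ℝ) - 1) * K) := by
        gcongr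
    _ = _ := by field_simp; ring

theorem HasNeighborMatching.abs_lazyWalk_pow_sub_le (hM : HasNeighborMatching G) {d : ℕ}
    (hd : G.IsRegularOfDegree d) {g : V → ℝ} {K : ℝ}
    (hg : ∀ x y, G.Adj x y → |g x - g y| ≤ K) (t : ℕ) {x y : V} (h : G.Adj x y) :
    |((lazyWalk G) ^ t).mulVec g x - ((lazyWalk G) ^ t).mulVec g y|
      ≤ (1 - 1 / (d : ℝ)) ^ t * K := by
  induction t generalizing x y with
  | zero => simpa using hg x y h
  | succ t ih =>
    rw [pow_succ', ← Matrix.mulVec_mulVec, pow_succ', mul_assoc]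
    exact hM.abs_lazyWalk_sub_le hd (fun x y h => ih h) h

omit [Fintype V] [DecidableEq V] [DecidableRel G.Adj] in
theorem abs_sub_le_length_mul {g : V → ℝ} {K : ℝ} (hg : ∀ x y, G.Adj x y → |g x - g y| ≤ K)
    {x y : V} (w : G.Walk x y) : |g x - g y| ≤ w.length * K := by
  induction w with
  | nil => simp
  | @cons u v w h p ih =>
    rw [SimpleGraph.Walk.length_cons]
    push_cast
    calc |g u - g w| ≤ |g u - g v| + |g v - g w| := abs_sub_le _ _ _
      _ ≤ K + p.length * K := add_le_add (hg _ _ h) ih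
      _ = _ := by ring

theorem sum_lazyWalk_mulVec {d : ℕ} (hd : G.IsRegularOfDegree d) (hd0 : d ≠ 0) (g : V → ℝ) :
    ∑ x, (lazyWalk G).mulVec g x = ∑ x, g x := by
  have hd' : (d : ℝ) ≠ 0 := by exact_mod_cast hd0
  simp only [lazyWalk_mulVec hd hd0]
  rw [Finset.sum_add_distrib, ← Finset.mul_sum, ← Finset.mul_sum]
  have : ∑ x, ∑ z ∈ G.neighborFinset x, g z = d * ∑ x, g x := by
    rw [Finset.sum_comm' (t' := Finset.univ) (s' := fun z => G.neighborFinset z)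
      (by intro x y; simp [G.adj_comm])]
    simp only [Finset.sum_const, SimpleGraph.card_neighborFinset_eq_degree, hd _, nsmul_eq_mul]
    rw [Finset.mul_sum]
  rw [this]
  field_simp
  ring

theorem sum_lazyWalk_pow_mulVec {d : ℕ} (hd : G.IsRegularOfDegree d) (hd0 : d ≠ 0) (g : V → ℝ)
    (t : ℕ) : ∑ x, ((lazyWalk G) ^ t).mulVec g x = ∑ x, g x := by
  induction t with
  | zero => simp
  | succ t ih => rw [pow_succ', ← Matrix.mulVec_mulVec, sum_lazyWalk_mulVec hd hd0, ih]

/-- The contraction, summed along a walk of length at most D, bounds the oscillation of the evolved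
function. Its average is that of g, since the uniform distribution is stationary, and every value
lies within the oscillation of the average. -/
theorem HasNeighborMatching.abs_lazyWalk_pow_sub_average_le (hM : HasNeighborMatching G) {d D : ℕ}
    (hd : G.IsRegularOfDegree d) (hd0 : d ≠ 0)
    (hD : ∀ x y, ∃ w : G.Walk x y, w.length ≤ D) {g : V → ℝ}
    (hg : ∀ x y, |g x - g y| ≤ 1) (t : ℕ) (x : V) :
    |((lazyWalk G) ^ t).mulVec g x - ∑ y, (Fintype.card V : ℝ)⁻¹ * g y|
      ≤ D * (1 - 1 / (d : ℝ)) ^ t := by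
  have hd1 : (1 : ℝ) ≤ d := by exact_mod_cast Nat.one_le_iff_ne_zero.2 hd0
  have hr : (0 : ℝ) ≤ 1 - 1 / (d : ℝ) := by
    rw [sub_nonneg, div_le_one (by linarith)]; exact hd1
  have hV : (0 : ℝ) < Fintype.card V := by
    exact_mod_cast Fintype.card_pos_iff.2 ⟨x⟩
  set F := ((lazyWalk G) ^ t).mulVec g with hF
  have hxy : ∀ y, |F x - F y| ≤ D * (1 - 1 / (d : ℝ)) ^ t := by
    intro y
    obtain ⟨w, hw⟩ := hD x y
    refine (abs_sub_le_length_mul (K := (1 - 1 / (d : ℝ)) ^ t) ?_ w).trans ?_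
    · intro u v h
      simpa using hM.abs_lazyWalk_pow_sub_le hd (fun x y _ => hg x y) t h
    · gcongr
  have e : F x - ∑ y, (Fintype.card V : ℝ)⁻¹ * g y =
      ∑ y, (Fintype.card V : ℝ)⁻¹ * (F x - F y) := by
    rw [← Finset.mul_sum, ← Finset.mul_sum, Finset.sum_sub_distrib, hF,
      sum_lazyWalk_pow_mulVec hd hd0, Finset.sum_const, Finset.card_univ, nsmul_eq_mul, mul_sub,
      inv_mul_cancel_left₀ hV.ne']
  rw [e]
  calc _ ≤ ∑ y, |(Fintype.card V : ℝ)⁻¹ * (F x - F y)| := Finset.abs_sum_le_sum_abs _ _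
    _ ≤ ∑ y : V, (Fintype.card V : ℝ)⁻¹ * (D * (1 - 1 / (d : ℝ)) ^ t) := by
        apply Finset.sum_le_sum
        intro y _
        rw [abs_mul, abs_of_pos (inv_pos.2 hV)]
        exact mul_le_mul_of_nonneg_left (hxy y) (inv_pos.2 hV).le
    _ = _ := by
        rw [Finset.sum_const, Finset.card_univ, nsmul_eq_mul, mul_inv_cancel_left₀ hV.ne']

theorem HasNeighborMatching.isEquilibrium (hM : HasNeighborMatching G) {d D : ℕ}
    (hd : G.IsRegularOfDegree d) (hd0 : d ≠ 0)
    (hD : ∀ x y, ∃ w : G.Walk x y, w.length ≤ D) :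
    IsEquilibrium (lazyWalk G) fun _ => (Fintype.card V : ℝ)⁻¹ := by
  intro x y
  have hd1 : (1 : ℝ) ≤ d := by exact_mod_cast Nat.one_le_iff_ne_zero.2 hd0
  have hr : (0 : ℝ) ≤ 1 - 1 / (d : ℝ) := by
    rw [sub_nonneg, div_le_one (by linarith)]; exact hd1
  have hr1 : 1 - 1 / (d : ℝ) < 1 := by
    have : 0 < 1 / (d : ℝ) := by positivity
    linarith
  have hb : ∀ t : ℕ, |((lazyWalk G) ^ t) x y - (Fintype.card V : ℝ)⁻¹|
      ≤ D * (1 - 1 / (d : ℝ)) ^ t := by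
    intro t
    have := hM.abs_lazyWalk_pow_sub_average_le hd hd0 hD (g := Pi.single y 1) (by
      intro u v
      by_cases hu : u = y <;> by_cases hv : v = y <;> simp [hu, hv]) t x
    simpa [Pi.single_apply] using this
  rw [tendsto_iff_dist_tendsto_zero]
  refine squeeze_zero (fun _ => dist_nonneg) hb ?_
  simpa using (tendsto_pow_atTop_nhds_zero_of_lt_one hr hr1).const_mul (D : ℝ)

theorem HasNeighborMatching.maxTVDist_le (hM : HasNeighborMatching G) {d D : ℕ}
    (hd : G.IsRegularOfDegree d) (hd0 : d ≠ 0)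
    (hD : ∀ x y, ∃ w : G.Walk x y, w.length ≤ D) (t : ℕ) :
    maxTVDist (lazyWalk G) (fun _ => (Fintype.card V : ℝ)⁻¹) t ≤ D * (1 - 1 / (d : ℝ)) ^ t := by
  have hd1 : (1 : ℝ) ≤ d := by exact_mod_cast Nat.one_le_iff_ne_zero.2 hd0
  have hr : (0 : ℝ) ≤ 1 - 1 / (d : ℝ) := by
    rw [sub_nonneg, div_le_one (by linarith)]; exact hd1
  refine Real.iSup_le (fun x => ?_) (by positivity)
  set π : ℝ := (Fintype.card V : ℝ)⁻¹
  -- Total variation distance is attained by this test function, half the sign of the discrepancy;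
  -- its oscillation is at most 1.
  set g : V → ℝ := fun y => if 0 ≤ ((lazyWalk G) ^ t) x y - π then 1 / 2 else -(1 / 2) with hgdef
  have hgv : ∀ y, g y = 1 / 2 ∨ g y = -(1 / 2) := by
    intro y; simp only [hgdef]; split_ifs <;> simp
  have := hM.abs_lazyWalk_pow_sub_average_le hd hd0 hD (g := g) (by
    intro u v
    rcases hgv u with hu | hu <;> rcases hgv v with hv | hv <;> rw [hu, hv] <;> norm_num) t x
  refine le_trans (le_of_eq ?_) ((le_abs_self _).trans this)
  simp only [Matrix.mulVec, dotProduct]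
  rw [← Finset.sum_sub_distrib, Finset.mul_sum]
  refine Finset.sum_congr rfl fun y _ => ?_
  simp only [hgdef]
  split_ifs with h
  · rw [abs_of_nonneg h]; ring
  · rw [abs_of_neg (not_le.1 h)]; ring

end LipschitzContraction

/-! ### From contraction to the mixing time -/

theorem exists_mixingTime_eq {V : Type*} [Fintype V] [DecidableEq V] {P : Matrix V V ℝ}
    {π : V → ℝ} {t₀ : ℕ} (h : maxTVDist P π t₀ ≤ 1 / 4) :
    ∃ t : ℕ, mixingTime P π = (t : ℕ∞) ∧ t ≤ t₀ := by
  have h1 : mixingTime P π ≤ (t₀ : ℕ∞) := iInf₂_le t₀ h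
  obtain ⟨t, ht⟩ := ENat.ne_top_iff_exists.1 (ne_top_of_le_ne_top (ENat.natCast_ne_top t₀) h1)
  refine ⟨t, ht.symm, ?_⟩
  rw [← ht] at h1
  exact_mod_cast h1

/-- The bound on the mixing time for graphs with a neighbour matching. -/
theorem HasNeighborMatching.mixingTime_le {V : Type*} [Fintype V] [DecidableEq V] [Nonempty V]
    {G : SimpleGraph V} [DecidableRel G.Adj] (hM : HasNeighborMatching G) {D : ℕ}
    (hD : ∀ x y, ∃ w : G.Walk x y, w.length ≤ D) :
    ∃ d : ℕ, G.IsRegularOfDegree d ∧ ∃ π : V → ℝ, IsEquilibrium (lazyWalk G) π ∧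
      ∃ t : ℕ, mixingTime (lazyWalk G) π = (t : ℕ∞) ∧
        (d = 0 → t = 0) ∧ (t : ℝ) ≤ ⌈(d : ℝ) * Real.log (4 * D)⌉₊ := by
  obtain ⟨x₀⟩ := ‹Nonempty V›
  have hd := hM.isRegularOfDegree (fun x y => ⟨(hD x y).choose⟩) x₀
  set d := G.degree x₀
  refine ⟨d, hd, fun _ => (Fintype.card V : ℝ)⁻¹, ?_⟩
  rcases eq_or_ne d 0 with h0 | h0
  -- Connected of degree 0 means a single vertex, where the chain is at equilibrium at time 0.
  · have hsub : ∀ x y : V, x = y := by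
      intro x y
      obtain ⟨w, -⟩ := hD x y
      cases w with
      | nil => rfl
      | @cons _ v _ h _ =>
        have := (G.degree_pos_iff_exists_adj x).2 ⟨v, h⟩
        rw [hd x, h0] at this
        exact absurd this (lt_irrefl _)
    have hP : lazyWalk G = 1 := by
      have : simpleWalk G = 1 := by
        ext x y
        rw [simpleWalk, Matrix.of_apply, hd x, h0, if_pos rfl, Matrix.one_apply]
      rw [lazyWalk, this, ← two_smul ℝ (1 : Matrix V V ℝ), smul_smul]
      norm_num
    have hcard : Fintype.card V = 1 := Fintype.card_eq_one_iff.2 ⟨x₀, fun y => hsub y x₀⟩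
    have h1 : ∀ x y : V, (1 : Matrix V V ℝ) x y = 1 := by
      intro x y; rw [hsub x y, Matrix.one_apply_eq]
    refine ⟨?_, 0, ?_, fun _ => rfl, by simp [h0]⟩
    · intro x y
      simp [hP, hcard, h1]
    · have : maxTVDist (lazyWalk G) (fun _ => (Fintype.card V : ℝ)⁻¹) 0 ≤ 1 / 4 := by
        refine Real.iSup_le (fun x => ?_) (by norm_num)
        simp [hcard, h1]
      obtain ⟨t, ht, hle⟩ := exists_mixingTime_eq this
      rw [ht, Nat.le_zero.1 hle]
  · refine ⟨hM.isEquilibrium hd h0 hD, ?_⟩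
    have hd1 : (1 : ℝ) ≤ d := by exact_mod_cast Nat.one_le_iff_ne_zero.2 h0
    have hD1 : (1 : ℝ) ≤ D := by
      obtain ⟨v, hv⟩ := (G.degree_pos_iff_exists_adj x₀).1 (Nat.pos_of_ne_zero h0)
      obtain ⟨w, hw⟩ := hD x₀ v
      have : w.length ≠ 0 := fun h => hv.ne (SimpleGraph.Walk.eq_of_length_eq_zero h)
      exact_mod_cast (by omega : 1 ≤ D)
    set t₀ := ⌈(d : ℝ) * Real.log (4 * D)⌉₊
    have ht₀ : (d : ℝ) * Real.log (4 * D) ≤ t₀ := Nat.le_ceil _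
    have : maxTVDist (lazyWalk G) (fun _ => (Fintype.card V : ℝ)⁻¹) t₀ ≤ 1 / 4 := by
      refine (hM.maxTVDist_le hd h0 hD t₀).trans ?_
      have h1 : (1 - 1 / (d : ℝ)) ^ t₀ ≤ Real.exp (-(1 / d)) ^ t₀ := by
        apply pow_le_pow_left₀
        · rw [sub_nonneg, div_le_one (by linarith)]; exact hd1
        · exact Real.one_sub_le_exp_neg _
      have h2 : Real.exp (-(1 / d)) ^ t₀ ≤ (4 * (D : ℝ))⁻¹ := by
        rw [← Real.exp_nat_mul, ← Real.exp_log (show 0 < (4 * (D : ℝ)) by positivity),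
          ← Real.exp_neg]
        apply Real.exp_le_exp.2
        have : Real.log (4 * D) ≤ t₀ / d := by
          rw [le_div_iff₀ (by linarith)]; linarith
        have e : (t₀ : ℝ) * -(1 / d) = -(t₀ / d) := by ring
        rw [e]; linarith
      calc (D : ℝ) * (1 - 1 / (d : ℝ)) ^ t₀ ≤ D * (4 * (D : ℝ))⁻¹ := by
            gcongr; exact h1.trans h2
        _ = 1 / 4 := by field_simp
    obtain ⟨t, ht, hle⟩ := exists_mixingTime_eq this
    exact ⟨t, ht, fun h => absurd h h0, by exact_mod_cast hle⟩

/-! ### Roots as short integer vectors -/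

section Lattice

variable {ι : Type*} [Fintype ι]

/-- The roots: integer vectors of squared length `2` and, if `hasShort`, also of squared
length `1`. -/
def IsRoot (hasShort : Prop) (v : ι → ℤ) : Prop :=
  v ⬝ᵥ v = 2 ∨ (hasShort ∧ v ⬝ᵥ v = 1)

variable {S : Prop} {a b c d p q r v w : ι → ℤ}

/-- Since x² and x have the same parity, squared length is additive modulo 2. -/
theorem dotProduct_self_emod_two (v : ι → ℤ) : (v ⬝ᵥ v) % 2 = (∑ i, v i) % 2 := by
  apply Int.ModEq.eq
  unfold dotProduct
  apply Int.ModEq.sum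
  intro i _
  rcases Int.emod_two_eq_zero_or_one (v i) with h | h <;> simp [Int.ModEq, Int.mul_emod, h]

theorem dotProduct_self_pos_of_ne_zero (h : v ≠ 0) : 0 < v ⬝ᵥ v := by
  have h0 : 0 ≤ v ⬝ᵥ v := Finset.sum_nonneg fun i _ => mul_self_nonneg (v i)
  rcases h0.lt_or_eq with h1 | h1
  · exact h1
  · exact absurd (dotProduct_self_eq_zero.1 h1.symm) h

theorem IsRoot.ne_zero (h : IsRoot S v) : v ≠ 0 := by
  rintro rfl
  simp [IsRoot] at h

theorem IsRoot.neg (h : IsRoot S v) : IsRoot S (-v) := by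
  simpa [IsRoot] using h

theorem not_isRoot_add_self (S : Prop) (v : ι → ℤ) : ¬ IsRoot S (v + v) := by
  unfold IsRoot
  rw [dotProduct_add, add_dotProduct]
  omega

theorem IsRoot.add_of_dotProduct_neg (hv : IsRoot S v) (hw : IsRoot S w) (h : v ⬝ᵥ w < 0)
    (hne : v + w ≠ 0) : IsRoot S (v + w) := by
  have h1 := dotProduct_self_pos_of_ne_zero hne
  have h2 : (v + w) ⬝ᵥ (v + w) = v ⬝ᵥ v + w ⬝ᵥ w + 2 * (v ⬝ᵥ w) := by
    rw [dotProduct_add, add_dotProduct, add_dotProduct, dotProduct_comm w v]; ring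
  unfold IsRoot at *
  rw [h2] at h1 ⊢
  by_cases hS : S <;> simp only [hS, true_and, false_and, or_false] at hv hw ⊢ <;> omega

/-- The alternative behind the four-cycles in interchange graphs. -/
theorem IsRoot.add_iff_not_add (ha : IsRoot S a) (hb : IsRoot S b) (hc : IsRoot S c)
    (hd : IsRoot S d) (hab : IsRoot S (a + b)) (h0 : a + b + c + d = 0) (hac : a + c ≠ 0)
    (had : a + d ≠ 0) : IsRoot S (a + c) ↔ ¬ IsRoot S (a + d) := by
  have hac' := dotProduct_self_pos_of_ne_zero hac
  have had' := dotProduct_self_pos_of_ne_zero had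
  have p1 := dotProduct_self_emod_two a
  have p2 := dotProduct_self_emod_two b
  have p3 := dotProduct_self_emod_two c
  have p4 := dotProduct_self_emod_two d
  have p5 := dotProduct_self_emod_two (a + b)
  have p6 := dotProduct_self_emod_two (a + c)
  have p7 := dotProduct_self_emod_two (a + d)
  simp only [Pi.add_apply, Finset.sum_add_distrib] at p5 p6 p7
  obtain rfl : d = -a - b - c := by
    linear_combination h0
  have hs : ∑ i, (-a - b - c) i = -∑ i, a i - ∑ i, b i - ∑ i, c i := by
    simp [Finset.sum_sub_distrib]
  rw [hs] at p4 p7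
  -- This identity and the parities leave exactly one of a + c and a + d with squared length at most
  -- 2. For four long roots, for instance, the two squared lengths are even, positive and add up to
  -- 6.
  have e : a ⬝ᵥ a + b ⬝ᵥ b + c ⬝ᵥ c + (-a - b - c) ⬝ᵥ (-a - b - c) =
      (a + b) ⬝ᵥ (a + b) + (a + c) ⬝ᵥ (a + c) + (a + (-a - b - c)) ⬝ᵥ (a + (-a - b - c)) := by
    simp only [dotProduct_add, add_dotProduct, dotProduct_sub, sub_dotProduct, dotProduct_neg,
      neg_dotProduct, dotProduct_comm b a, dotProduct_comm c a, dotProduct_comm c b]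
    ring
  unfold IsRoot at *
  generalize (a + (-a - b - c)) ⬝ᵥ (a + (-a - b - c)) = nad at *
  generalize (a + c) ⬝ᵥ (a + c) = nac at *
  generalize (a + b) ⬝ᵥ (a + b) = nab at *
  generalize (-a - b - c) ⬝ᵥ (-a - b - c) = nd at *
  generalize a ⬝ᵥ a = na at *
  generalize b ⬝ᵥ b = nb at *
  generalize c ⬝ᵥ c = nc at *
  generalize ∑ i, a i = sa at *
  generalize ∑ i, b i = sb at *
  generalize ∑ i, c i = sc at *
  clear h0 hs hac had
  have q5 : (nab - na - nb) % 2 = 0 := by clear * - p1 p2 p5; omega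
  have q6 : (nac - na - nc) % 2 = 0 := by clear * - p1 p3 p6; omega
  have q7 : (nad - nb - nc) % 2 = 0 := by clear * - p2 p3 p7; omega
  have q4 : (nd - na - nb - nc) % 2 = 0 := by clear * - p1 p2 p3 p4; omega
  clear p1 p2 p3 p4 p5 p6 p7
  by_cases hS : S
  · simp only [hS, true_and] at *
    rcases ha with rfl | rfl <;> rcases hb with rfl | rfl <;> rcases hc with rfl | rfl <;>
      rcases hab with rfl | rfl <;> omega
  · simp only [hS, false_and, or_false] at *
    subst ha hb hc hab
    omega

/-! ### Half systems and flips of zero triples -/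

/-- A choice of one root out of each pair of opposite roots. -/
structure IsHalfSystem (S : Prop) (H : Set (ι → ℤ)) : Prop where
  isRoot : ∀ {v}, v ∈ H → IsRoot S v
  mem_or : ∀ {v}, IsRoot S v → v ∈ H ∨ -v ∈ H
  neg_notMem : ∀ {v}, v ∈ H → -v ∉ H

/-- Replacing `p`, `q` and `r` by their opposites. -/
def flipThree (H : Set (ι → ℤ)) (p q r : ι → ℤ) : Set (ι → ℤ) :=
  (H \ {p, q, r}) ∪ {v | -v ∈ ({p, q, r} : Set (ι → ℤ))}

omit [Fintype ι] in
theorem mem_flipThree {H : Set (ι → ℤ)} : v ∈ flipThree H p q r ↔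
    (v ∈ H ∧ v ≠ p ∧ v ≠ q ∧ v ≠ r) ∨ v = -p ∨ v = -q ∨ v = -r := by
  simp [flipThree, neg_eq_iff_eq_neg]

/-- Three elements of `H` with sum zero. -/
structure IsZeroTriple (H : Set (ι → ℤ)) (p q r : ι → ℤ) : Prop where
  mem₁ : p ∈ H
  mem₂ : q ∈ H
  mem₃ : r ∈ H
  sum : p + q + r = 0

variable {H : Set (ι → ℤ)}

omit [Fintype ι] in
theorem IsZeroTriple.rotate (h : IsZeroTriple H p q r) : IsZeroTriple H q r p :=
  ⟨h.mem₂, h.mem₃, h.mem₁, by rw [← h.sum]; ring⟩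

omit [Fintype ι] in
theorem IsZeroTriple.swap (h : IsZeroTriple H p q r) : IsZeroTriple H p r q :=
  ⟨h.mem₁, h.mem₃, h.mem₂, by rw [← h.sum]; ring⟩

omit [Fintype ι] in
theorem flipThree_rotate (H : Set (ι → ℤ)) (p q r : ι → ℤ) :
    flipThree H q r p = flipThree H p q r := by
  ext v; simp only [mem_flipThree]; tauto

omit [Fintype ι] in
theorem flipThree_swap (H : Set (ι → ℤ)) (p q r : ι → ℤ) :
    flipThree H p r q = flipThree H p q r := by
  ext v; simp only [mem_flipThree]; tauto

theorem IsHalfSystem.ne_neg (hH : IsHalfSystem S H) (hv : v ∈ H) (hw : w ∈ H) : v ≠ -w := by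
  rintro rfl; exact hH.neg_notMem hw hv

theorem IsHalfSystem.ne_of_zeroTriple (hH : IsHalfSystem S H) (h : IsZeroTriple H p q r) :
    p ≠ q := by
  rintro rfl
  have h1 := not_isRoot_add_self S p
  rw [show p + p = -r by linear_combination h.sum] at h1
  exact h1 (hH.isRoot h.mem₃).neg

theorem IsHalfSystem.flipThree (hH : IsHalfSystem S H) (h : IsZeroTriple H p q r) :
    IsHalfSystem S (flipThree H p q r) := by
  have hp := h.mem₁
  have hq := h.mem₂
  have hr := h.mem₃
  refine ⟨?_, ?_, ?_⟩
  · intro v hv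
    rw [mem_flipThree] at hv
    rcases hv with (⟨hv, -⟩ | rfl | rfl | rfl)
    · exact hH.isRoot hv
    · exact (hH.isRoot hp).neg
    · exact (hH.isRoot hq).neg
    · exact (hH.isRoot hr).neg
  · intro v hv
    simp only [mem_flipThree, neg_inj]
    rcases hH.mem_or hv with h1 | h1
    · by_cases v = p <;> by_cases v = q <;> by_cases v = r <;> simp_all
    · by_cases h2 : v = -p <;> by_cases h3 : v = -q <;> by_cases h4 : v = -r <;>
        simp_all [neg_eq_iff_eq_neg]
  · have hne : ∀ ⦃v w⦄, v ∈ H → w ∈ H → v ≠ -w := fun _ _ => hH.ne_neg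
    intro v hv
    rw [mem_flipThree] at hv
    rcases hv with (⟨hv, h1, h2, h3⟩ | rfl | rfl | rfl) <;>
      simp only [mem_flipThree, neg_inj, neg_neg] <;>
      rintro (⟨h4, h5, h6, h7⟩ | h4 | h4 | h4)
    · exact hH.neg_notMem hv h4
    all_goals first
      | contradiction
      | exact hne hp hp h4
      | exact hne hp hq h4
      | exact hne hp hr h4
      | exact hne hq hp h4
      | exact hne hq hq h4
      | exact hne hq hr h4
      | exact hne hr hp h4
      | exact hne hr hq h4
      | exact hne hr hr h4

/-- A flipped triple can be read off from the two half systems; injectivity of the matching rests on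
this. -/
theorem IsHalfSystem.diff_flipThree (hH : IsHalfSystem S H) (h : IsZeroTriple H p q r) :
    H \ _root_.flipThree H p q r = {p, q, r} := by
  have hp := h.mem₁
  have hq := h.mem₂
  have hr := h.mem₃
  have hne : ∀ ⦃v w⦄, v ∈ H → w ∈ H → v ≠ -w := fun _ _ => hH.ne_neg
  ext v
  simp only [mem_flipThree, Set.mem_sdiff, Set.mem_insert_iff,
    Set.mem_singleton_iff]
  constructor
  · rintro ⟨h1, h2⟩; tauto
  · rintro (rfl | rfl | rfl)
    · exact ⟨hp, by simp [hne hp hp, hne hp hq, hne hp hr]⟩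
    · exact ⟨hq, by simp [hne hq hp, hne hq hq, hne hq hr]⟩
    · exact ⟨hr, by simp [hne hr hp, hne hr hq, hne hr hr]⟩

omit [Fintype ι] in
theorem flipThree_congr {p' q' r' : ι → ℤ} (h : ({p, q, r} : Set (ι → ℤ)) = {p', q', r'}) :
    flipThree H p q r = flipThree H p' q' r' := by
  rw [flipThree, flipThree, h]

/-! ### Four-cycles of flips -/

/-- A flip `Z` of `H` is matched to a flip `W` of the flip `Y` of `H`: either both flip the same
triple, or the triple of `Z` meets that of `Y`. -/
inductive FlipMatch (H Y Z W : Set (ι → ℤ)) : Prop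
  | disjoint (p q r : ι → ℤ) (h : IsZeroTriple H p q r) (hY : IsZeroTriple Y p q r)
      (hZ : Z = flipThree H p q r) (hW : W = flipThree Y p q r)
  | meet (α β γ δ ε ρ : ι → ℤ) (hΔ : IsZeroTriple H α β γ) (hY : Y = flipThree H α β γ)
      (hΓ : IsZeroTriple H α δ ε) (hρ : ρ ∈ H) (hsum : ρ + β = δ) (hεβ : ε ≠ β)
      (hZ : Z = flipThree H α δ ε) (hW : W = flipThree Y (-γ) ε ρ)

/-- The third root in a matched pair of flips is not in the flipped triple. -/
theorem IsHalfSystem.isZeroTriple_of_meet {α β γ δ ε ρ : ι → ℤ} (hH : IsHalfSystem S H)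
    (hΔ : IsZeroTriple H α β γ) (hΓ : IsZeroTriple H α δ ε) (hρ : ρ ∈ H) (hsum : ρ + β = δ) (hεβ : ε ≠ β) :
    IsZeroTriple (_root_.flipThree H α β γ) (-γ) ε ρ := by
  have h1 := hΔ.sum
  have h2 := hΓ.sum
  have hne : ∀ ⦃v w⦄, v ∈ H → w ∈ H → v + w ≠ 0 := fun v w hv hw h =>
    hH.ne_neg hv hw (eq_neg_of_add_eq_zero_left h)
  have hr : ∀ ⦃v w⦄, v ∈ H → w + w ≠ v := fun v w hv h =>
    not_isRoot_add_self S w (h ▸ hH.isRoot hv)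
  have h0 : ∀ ⦃v⦄, v ∈ H → v ≠ 0 := fun v hv => (hH.isRoot hv).ne_zero
  refine ⟨?_, ?_, ?_, ?_⟩
  · rw [mem_flipThree]; tauto
  · rw [mem_flipThree]
    refine Or.inl ⟨hΓ.mem₃, (hH.ne_of_zeroTriple hΓ.rotate.rotate), ?_, ?_⟩
    · exact hεβ
    · rintro rfl
      exact h0 hρ (by linear_combination h2 - h1 + hsum)
  · rw [mem_flipThree]
    refine Or.inl ⟨hρ, ?_, ?_, ?_⟩
    · rintro rfl
      exact hne hΓ.mem₂ hΔ.mem₃ (by linear_combination h1 - hsum)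
    · rintro rfl
      exact hr hΓ.mem₂ hsum
    · rintro rfl
      exact h0 hΓ.mem₃ (by linear_combination h2 - h1 + hsum)
  · linear_combination h2 - h1 + hsum

theorem FlipMatch.injective {Y Z Z' W : Set (ι → ℤ)} (hH : IsHalfSystem S H)
    (hYs : IsHalfSystem S Y) (h : FlipMatch H Y Z W) (h' : FlipMatch H Y Z' W) : Z = Z' := by
  -- The triple flipped from `Y` to `W` lies in `H` in the disjoint case and contains -γ, which is
  -- not in `H`, in the other. Hence the two kinds of match never share a `W`.
  have hdd : ∀ ⦃p q r α β γ δ ε ρ⦄, IsZeroTriple H p q r → IsZeroTriple Y p q r →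
      W = flipThree Y p q r → IsZeroTriple H α β γ → Y = flipThree H α β γ →
      IsZeroTriple H α δ ε → ρ ∈ H → ρ + β = δ → ε ≠ β → W ≠ flipThree Y (-γ) ε ρ := by
    rintro p q r α β γ δ ε ρ h1 h2 h3 h4 h5 h6 h7 h8 hεβ h9
    have h10 := hYs.diff_flipThree h2
    have h11 := hH.isZeroTriple_of_meet h4 h6 h7 h8 hεβ
    rw [← h5] at h11
    rw [← h3, h9, hYs.diff_flipThree h11] at h10
    have : -γ ∈ ({p, q, r} : Set (ι → ℤ)) := by rw [← h10]; simp
    have h12 := hH.neg_notMem h4.mem₃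
    rcases this with h | h | h
    · exact h12 (h ▸ h1.mem₁)
    · exact h12 (h ▸ h1.mem₂)
    · exact h12 ((Set.mem_singleton_iff.1 h) ▸ h1.mem₃)
  rcases h with ⟨p, q, r, h1, h2, hZ, hW⟩ | ⟨α, β, γ, δ, ε, ρ, hΔ, hY, hΓ, hρ, hsum, hεβ, hZ, hW⟩
  · rcases h' with ⟨p', q', r', h1', h2', hZ', hW'⟩ |
      ⟨α', β', γ', δ', ε', ρ', hΔ', hY', hΓ', hρ', hsum', hεβ', hZ', hW'⟩
    · rw [hZ, hZ']
      apply flipThree_congr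
      rw [← hYs.diff_flipThree h2, ← hYs.diff_flipThree h2', ← hW, ← hW']
    · exact absurd hW' (hdd h1 h2 hW hΔ' hY' hΓ' hρ' hsum' hεβ')
  · rcases h' with ⟨p', q', r', h1', h2', hZ', hW'⟩ |
      ⟨α', β', γ', δ', ε', ρ', hΔ', hY', hΓ', hρ', hsum', hεβ', hZ', hW'⟩
    · exact absurd hW (hdd h1' h2' hW' hΔ hY hΓ hρ hsum hεβ)
    · have hT := hH.isZeroTriple_of_meet hΔ hΓ hρ hsum hεβ
      have hT' := hH.isZeroTriple_of_meet hΔ' hΓ' hρ' hsum' hεβ'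
      rw [← hY] at hT
      rw [← hY'] at hT'
      have e1 : ({α, β, γ} : Set (ι → ℤ)) = {α', β', γ'} := by
        rw [← hH.diff_flipThree hΔ, ← hH.diff_flipThree hΔ', ← hY, ← hY']
      have e2 : ({-γ, ε, ρ} : Set (ι → ℤ)) = {-γ', ε', ρ'} := by
        rw [← hYs.diff_flipThree hT, ← hYs.diff_flipThree hT', ← hW, ← hW']
      -- Here -γ is recognised as the only root of the second triple outside `H`.
      have hγ : γ' = γ := by
        have : -γ' ∈ ({-γ, ε, ρ} : Set (ι → ℤ)) := by rw [e2]; simp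
        have h12 := hH.neg_notMem hΔ'.mem₃
        rcases this with h | h | h
        · exact neg_injective h
        · exact absurd (h ▸ hΓ.mem₃) h12
        · exact absurd ((Set.mem_singleton_iff.1 h) ▸ hρ) h12
      subst hγ
      have hε : ε' = ε ∨ ε' = ρ := by
        have : ε' ∈ ({-γ', ε, ρ} : Set (ι → ℤ)) := by rw [e2]; simp
        rcases this with h | h | h
        · exact absurd (h ▸ hΓ'.mem₃) (hH.neg_notMem hΔ'.mem₃)
        · exact Or.inl h
        · exact Or.inr h
      have hα : α' = α ∨ α' = β := by
        have : α' ∈ ({α, β, γ'} : Set (ι → ℤ)) := by rw [e1]; simp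
        rcases this with h | h | h
        · exact Or.inl h
        · exact Or.inr h
        · exact absurd (Set.mem_singleton_iff.1 h).symm (hH.ne_of_zeroTriple hΔ'.rotate.rotate)
      have s1 := hΔ.sum
      have s2 := hΓ.sum
      have s1' := hΔ'.sum
      have s2' := hΓ'.sum
      have rα := hH.isRoot hΔ.mem₁
      have rβ := hH.isRoot hΔ.mem₂
      have rγ := hH.isRoot hΔ.mem₃
      have rε := hH.isRoot hΓ.mem₃
      have rδ := hH.isRoot hΓ.mem₂
      have rδ' := hH.isRoot hΓ'.mem₂
      have rρ := hH.isRoot hρ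
      -- Exchanging only α with β, or only ε with ρ, would make two complementary sums roots,
      -- against `IsRoot.add_iff_not_add`. Exchanging both would put δ and -δ in `H`.
      rcases hα with rfl | rfl <;> rcases hε with rfl | rfl
      · have : δ' = δ := by linear_combination s2' - s2
        rw [hZ, hZ', this]
      · have e3 : α' + ε = -δ := by linear_combination s2
        have e4 : α' + ε' = -δ' := by linear_combination s2'
        have := IsRoot.add_iff_not_add rα rβ rε rρ
          (by rw [show α' + β = -γ' by linear_combination s1]; exact rγ.neg)
          (by linear_combination s2 + hsum)
          (by rw [e3]; exact rδ.neg.ne_zero) (by rw [e4]; exact rδ'.neg.ne_zero)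
        rw [e3, e4] at this
        exact absurd rδ'.neg (this.1 rδ.neg)
      · have e3 : ε' + α = -δ := by linear_combination s2
        have e4 : ε' + α' = -δ' := by linear_combination s2'
        have := IsRoot.add_iff_not_add rε rρ rα rβ
          (by rw [show ε' + ρ = γ' by linear_combination s2 + hsum - s1]; exact rγ)
          (by linear_combination s2 + hsum)
          (by rw [e3]; exact rδ.neg.ne_zero) (by rw [e4]; exact rδ'.neg.ne_zero)
        rw [e3, e4] at this
        exact absurd rδ'.neg (this.1 rδ.neg)
      · have : δ' = -δ := by linear_combination s2' - hsum
        exact absurd hΓ.mem₂ (by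
          have := hH.neg_notMem hΓ'.mem₂
          rwa [‹δ' = -δ›, neg_neg] at this)

/-- This closes the four-cycle. For disjoint triples the two flips commute; when they meet, both
routes from `H` to `W` reverse exactly α, β, ε and ρ. -/
theorem FlipMatch.exists_flip {Y Z W : Set (ι → ℤ)} {α β γ : ι → ℤ} (hH : IsHalfSystem S H)
    (hΔ : IsZeroTriple H α β γ) (hY : Y = _root_.flipThree H α β γ) (h : FlipMatch H Y Z W) :
    W ≠ H ∧ ∃ p q r, IsZeroTriple Z p q r ∧ W = _root_.flipThree Z p q r := by
  have hne : ∀ ⦃v w⦄, v ∈ H → w ∈ H → v ≠ -w := fun _ _ => hH.ne_neg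
  rcases h with ⟨p, q, r, h1, h2, hZ, hW⟩ |
    ⟨α, β, γ, δ, ε, ρ, hΔ, hY, hΓ, hρ, hsum, hεβ, hZ, hW⟩
  · subst hY hZ hW
    have a1 := hΔ.mem₁
    have a2 := hΔ.mem₂
    have a3 := hΔ.mem₃
    have b1 := h1.mem₁
    have b2 := h1.mem₂
    have b3 := h1.mem₃
    have c1 := h2.mem₁
    have c2 := h2.mem₂
    have c3 := h2.mem₃
    simp only [mem_flipThree, hne b1 a1, hne b1 a2, hne b1 a3, hne b2 a1, hne b2 a2, hne b2 a3,
      hne b3 a1, hne b3 a2, hne b3 a3, or_false] at c1 c2 c3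
    refine ⟨?_, α, β, γ, ⟨?_, ?_, ?_, hΔ.sum⟩, ?_⟩
    · intro h
      have := Set.ext_iff.1 h p
      simp [mem_flipThree, b1, hne b1 b1, hne b1 b2, hne b1 b3] at this
    · simp only [mem_flipThree]; grind
    · simp only [mem_flipThree]; grind
    · simp only [mem_flipThree]; grind
    · ext v
      simp only [mem_flipThree]
      grind
  · have hT := hH.isZeroTriple_of_meet hΔ hΓ hρ hsum hεβ
    subst hY hZ hW
    have a1 := hΔ.mem₁
    have a2 := hΔ.mem₂
    have a3 := hΔ.mem₃
    have b2 := hΓ.mem₂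
    have b3 := hΓ.mem₃
    have c2 := hT.mem₂
    have c3 := hT.mem₃
    simp only [mem_flipThree, hne b3 a1, hne b3 a2, hne b3 a3, hne hρ a1, hne hρ a2, hne hρ a3,
      or_false] at c2 c3
    have d1 := hH.ne_of_zeroTriple hΔ
    have d2 := hH.ne_of_zeroTriple hΔ.rotate
    have d3 := hH.ne_of_zeroTriple hΔ.rotate.rotate
    have d4 := hH.ne_of_zeroTriple hΓ
    have d5 := hH.ne_of_zeroTriple hΓ.rotate
    have hβδ : β ≠ δ := by
      rintro rfl
      exact (hH.isRoot hρ).ne_zero (by linear_combination hsum)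
    have hρδ : ρ ≠ δ := by
      rintro rfl
      exact (hH.isRoot a2).ne_zero (by linear_combination hsum)
    have hρε : ρ ≠ ε := by
      have := hH.flipThree hΔ |>.ne_of_zeroTriple hT.rotate
      exact this.symm
    have hγδ : γ ≠ δ := by
      rintro rfl
      exact hεβ (by linear_combination hΓ.sum - hΔ.sum)
    -- The flip of {α, δ, ε} turned δ into -δ; flipping {β, -δ, ρ} turns it back.
    refine ⟨?_, β, -δ, ρ, ⟨?_, ?_, ?_, by linear_combination hsum⟩, ?_⟩
    · intro h
      have := Set.ext_iff.1 h ε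
      simp [mem_flipThree, b3, hne b3 b3, hne b3 hρ, c2] at this
    · simp only [mem_flipThree]; grind
    · simp only [mem_flipThree]; grind
    · simp only [mem_flipThree]; grind
    · ext v
      simp only [mem_flipThree, neg_neg]
      grind

/-- Since δ + ε = β + γ, the alternative for δ, ε, -β, -γ makes δ - β or δ - γ a root. If its
negative is the one in `H`, swapping the labels in both triples corrects the sign, because δ - β =
-(ε - γ). -/
theorem IsHalfSystem.exists_meet {α β γ δ ε : ι → ℤ} (hH : IsHalfSystem S H)
    (hΔ : IsZeroTriple H α β γ) (hΓ : IsZeroTriple H α δ ε) (hεβ : ε ≠ β) (hδβ : δ ≠ β) :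
    ∃ β' γ' δ' ε' ρ, IsZeroTriple H α β' γ' ∧ ({α, β', γ'} : Set (ι → ℤ)) = {α, β, γ} ∧
      IsZeroTriple H α δ' ε' ∧ ({α, δ', ε'} : Set (ι → ℤ)) = {α, δ, ε} ∧
      ρ ∈ H ∧ ρ + β' = δ' ∧ ε' ≠ β' := by
  have s1 := hΔ.sum
  have s2 := hΓ.sum
  have hεγ : ε ≠ γ := by
    rintro rfl; exact hδβ (by linear_combination s2 - s1)
  have hδγ : δ ≠ γ := by
    rintro rfl; exact hεβ (by linear_combination s2 - s1)
  have sw1 : ({α, γ, β} : Set (ι → ℤ)) = {α, β, γ} := by rw [Set.pair_comm]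
  have sw2 : ({α, ε, δ} : Set (ι → ℤ)) = {α, δ, ε} := by rw [Set.pair_comm]
  have key := IsRoot.add_iff_not_add (hH.isRoot hΓ.mem₂) (hH.isRoot hΓ.mem₃)
    (hH.isRoot hΔ.mem₂).neg (hH.isRoot hΔ.mem₃).neg
    (by rw [show δ + ε = -α by linear_combination s2]; exact (hH.isRoot hΔ.mem₁).neg)
    (by linear_combination s2 - s1)
    (fun h => hδβ (by linear_combination h)) (fun h => hδγ (by linear_combination h))
  by_cases hr : IsRoot S (δ + -β)
  · rcases hH.mem_or hr with h | h
    · exact ⟨β, γ, δ, ε, _, hΔ, rfl, hΓ, rfl, h, by ring, hεβ⟩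
    · exact ⟨γ, β, ε, δ, _, hΔ.swap, sw1, hΓ.swap, sw2, h, by linear_combination s1 - s2, hδγ⟩
  · have hr' : IsRoot S (δ + -γ) := by
      by_contra h; exact hr (key.2 h)
    rcases hH.mem_or hr' with h | h
    · exact ⟨γ, β, δ, ε, _, hΔ.swap, sw1, hΓ, rfl, h, by ring, hεγ⟩
    · exact ⟨β, γ, ε, δ, _, hΔ, rfl, hΓ.swap, sw2, h, by linear_combination s1 - s2, hδβ⟩

theorem FlipMatch.exists_match {Y Z : Set (ι → ℤ)} {α β γ p q r : ι → ℤ} (hH : IsHalfSystem S H)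
    (hΔ : IsZeroTriple H α β γ) (hY : Y = _root_.flipThree H α β γ) (hΓ : IsZeroTriple H p q r)
    (hZ : Z = _root_.flipThree H p q r) (hZY : Z ≠ Y) :
    ∃ p' q' r', IsZeroTriple Y p' q' r' ∧ FlipMatch H Y Z (_root_.flipThree Y p' q' r') := by
  -- Rotating both triples brings a shared root to the front. A second shared root would force equal
  -- triples, since two roots of a zero triple determine the third.
  have common : ∀ ⦃α β γ p q r : ι → ℤ⦄, IsZeroTriple H α β γ → Y = _root_.flipThree H α β γ →
      IsZeroTriple H p q r → Z = _root_.flipThree H p q r → p = α →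
      ∃ p' q' r', IsZeroTriple Y p' q' r' ∧ FlipMatch H Y Z (_root_.flipThree Y p' q' r') := by
    rintro α β γ _ δ ε hΔ hY hΓ hZ rfl
    have s1 := hΔ.sum
    have s2 := hΓ.sum
    have hεβ : ε ≠ β := by
      rintro rfl
      have : δ = γ := by linear_combination s2 - s1
      subst this
      exact hZY (by rw [hZ, hY, flipThree_swap])
    have hδβ : δ ≠ β := by
      rintro rfl
      have : ε = γ := by linear_combination s2 - s1
      subst this
      exact hZY (by rw [hZ, hY])
    obtain ⟨β', γ', δ', ε', ρ, hΔ', eΔ, hΓ', eΓ, hρ, hsum, hne⟩ := hH.exists_meet hΔ hΓ hεβ hδβ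
    rw [← flipThree_congr eΔ] at hY
    rw [← flipThree_congr eΓ] at hZ
    refine ⟨-γ', ε', ρ, ?_, .meet _ _ _ _ _ _ hΔ' hY hΓ' hρ hsum hne hZ rfl⟩
    rw [hY]
    exact hH.isZeroTriple_of_meet hΔ' hΓ' hρ hsum hne
  have hY2 := hY.trans (flipThree_rotate H α β γ).symm
  have hY3 := hY2.trans (flipThree_rotate H β γ α).symm
  have hZ2 := hZ.trans (flipThree_rotate H p q r).symm
  have hZ3 := hZ2.trans (flipThree_rotate H q r p).symm
  by_cases hd : (p ≠ α ∧ p ≠ β ∧ p ≠ γ) ∧ (q ≠ α ∧ q ≠ β ∧ q ≠ γ) ∧ (r ≠ α ∧ r ≠ β ∧ r ≠ γ)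
  · have hT : IsZeroTriple Y p q r := by
      subst hY
      exact ⟨mem_flipThree.2 (Or.inl ⟨hΓ.mem₁, hd.1⟩), mem_flipThree.2 (Or.inl ⟨hΓ.mem₂, hd.2.1⟩),
        mem_flipThree.2 (Or.inl ⟨hΓ.mem₃, hd.2.2⟩), hΓ.sum⟩
    exact ⟨p, q, r, hT, .disjoint p q r hΓ hT hZ rfl⟩
  · simp only [not_and_or, not_not] at hd
    rcases hd with (hd | hd | hd) | (hd | hd | hd) | (hd | hd | hd)
    · exact common hΔ hY hΓ hZ hd
    · exact common hΔ.rotate hY2 hΓ hZ hd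
    · exact common hΔ.rotate.rotate hY3 hΓ hZ hd
    · exact common hΔ hY hΓ.rotate hZ2 hd
    · exact common hΔ.rotate hY2 hΓ.rotate hZ2 hd
    · exact common hΔ.rotate.rotate hY3 hΓ.rotate hZ2 hd
    · exact common hΔ hY hΓ.rotate.rotate hZ3 hd
    · exact common hΔ.rotate hY2 hΓ.rotate.rotate hZ3 hd
    · exact common hΔ.rotate.rotate hY3 hΓ.rotate.rotate hZ3 hd

/-! ### Connecting half systems with equal sum -/

/-- A set of roots that is closed under addition and contains no opposite roots has no nonempty
multiset with sum zero. -/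
theorem multiset_sum_ne_zero {N : Set (ι → ℤ)} (hN : ∀ v ∈ N, IsRoot S v)
    (hneg : ∀ v ∈ N, -v ∉ N) (hadd : ∀ v ∈ N, ∀ w ∈ N, IsRoot S (v + w) → v + w ∈ N)
    (m : Multiset (ι → ℤ)) (hm : m ≠ 0) (hmN : ∀ v ∈ m, v ∈ N) : m.sum ≠ 0 := by
  induction hk : m.card using Nat.strong_induction_on generalizing m with
  | _ k ih =>
    subst hk
    obtain ⟨v, hv⟩ := Multiset.exists_mem_of_ne_zero hm
    obtain ⟨m', rfl⟩ := Multiset.exists_cons_of_mem hv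
    intro hs
    rw [Multiset.sum_cons] at hs
    have hvN := hmN v hv
    have hdot : ∀ m : Multiset (ι → ℤ), v ⬝ᵥ m.sum = (m.map fun w => v ⬝ᵥ w).sum := by
      intro m
      induction m using Multiset.induction_on with
      | empty => simp
      | cons a m ih => simp [dotProduct_add, ih]
    -- The rest of the multiset sums to -v, so some w in it has negative product with v. Then v + w
    -- is a root in `N`, and merging the two gives a smaller multiset with sum zero.
    have hex : ∃ w ∈ m', v ⬝ᵥ w < 0 := by
      by_contra! hcon
      have h1 : 0 ≤ v ⬝ᵥ m'.sum := by
        rw [hdot]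
        apply Multiset.sum_nonneg
        intro x hx
        obtain ⟨w, hw, rfl⟩ := Multiset.mem_map.1 hx
        exact hcon w hw
      rw [show m'.sum = -v by linear_combination hs, dotProduct_neg] at h1
      have := dotProduct_self_pos_of_ne_zero (hN v hvN).ne_zero
      omega
    obtain ⟨w, hw, hvw⟩ := hex
    have hwN := hmN w (Multiset.mem_cons_of_mem hw)
    obtain ⟨m'', rfl⟩ := Multiset.exists_cons_of_mem hw
    have hne : v + w ≠ 0 := fun h => hneg w hwN (by
      rwa [show -w = v by linear_combination -h])
    have hmem := hadd v hvN w hwN ((hN v hvN).add_of_dotProduct_neg (hN w hwN) hvw hne)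
    refine ih _ (by simp) ((v + w) ::ₘ m'') (Multiset.cons_ne_zero) ?_ rfl ?_
    · intro u hu
      rcases Multiset.mem_cons.1 hu with rfl | hu
      · exact hmem
      · exact hmN u (by simp [hu])
    · rw [Multiset.sum_cons, add_assoc, ← Multiset.sum_cons]
      exact hs

/-- Two different half systems with the same sum can be brought closer by a flip in one of them. -/
theorem IsHalfSystem.exists_closer {H' : Set (ι → ℤ)} (hH : IsHalfSystem S H)
    (hH' : IsHalfSystem S H') (hfin : H.Finite) (hne : (H \ H').Nonempty)
    (hsum : ∑ᶠ v ∈ H \ H', v = 0) :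
    (∃ p q r, IsZeroTriple H p q r ∧ (_root_.flipThree H p q r \ H').ncard < (H \ H').ncard) ∨
    (∃ p q r, IsZeroTriple H' p q r ∧ (H \ _root_.flipThree H' p q r).ncard < (H \ H').ncard) := by
  have hNfin : (H \ H').Finite := hfin.sdiff
  obtain ⟨p, hp, q, hq, hr, hpq⟩ : ∃ p ∈ H \ H', ∃ q ∈ H \ H', IsRoot S (p + q) ∧
      p + q ∉ H \ H' := by
    by_contra! hcon
    refine multiset_sum_ne_zero (S := S) (N := H \ H') (fun v hv => hH.isRoot hv.1)
      (fun v hv h => hH.neg_notMem hv.1 h.1) hcon hNfin.toFinset.val ?_ ?_ ?_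
    · intro h
      obtain ⟨v, hv⟩ := hne
      have : v ∈ hNfin.toFinset.val := by simpa using hv
      rw [h] at this
      simp at this
    · intro v hv; simpa using hv
    · rw [finsum_mem_eq_finite_toFinset_sum _ hNfin] at hsum
      rw [← hsum, Finset.sum_eq_multiset_sum, Multiset.map_id']
  have hmem : ∀ v ∈ H \ H', -v ∈ H' := fun v hv =>
    (hH'.mem_or (hH.isRoot hv.1)).resolve_left hv.2
  have hpne : p ≠ q := by
    rintro rfl; exact not_isRoot_add_self S p hr
  -- Either flip removes p and q from the difference and adds at most p + q.
  have hcard : ∀ (X : Set (ι → ℤ)) (u : ι → ℤ), X ⊆ insert u ((H \ H') \ {p, q}) →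
      X.ncard < (H \ H').ncard := by
    intro X u hX
    have h1 : ((H \ H') \ {p, q}).ncard + 2 = (H \ H').ncard := by
      have := Set.ncard_sdiff_add_ncard_of_subset (s := {p, q}) (t := H \ H')
        (by rintro v (rfl | rfl) <;> assumption) hNfin
      rwa [Set.ncard_pair hpne] at this
    have h2 := Set.ncard_le_ncard hX ((hNfin.sdiff).insert u)
    have h3 := Set.ncard_insert_le u ((H \ H') \ {p, q})
    omega
  rcases hH.mem_or hr with h | h
  · have h' : p + q ∈ H' := by
      by_contra h'; exact hpq ⟨h, h'⟩
    right
    refine ⟨-p, -q, p + q, ⟨hmem p hp, hmem q hq, h', by ring⟩, hcard _ (p + q) ?_⟩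
    rintro v ⟨hv, hv'⟩
    rw [mem_flipThree, neg_neg, neg_neg] at hv'
    have h1 : v ≠ -p := hH.ne_neg hv hp.1
    have h2 : v ≠ -q := hH.ne_neg hv hq.1
    simp only [Set.mem_insert_iff, Set.mem_sdiff, Set.mem_singleton_iff]
    tauto
  · left
    refine ⟨p, q, -(p + q), ⟨hp.1, hq.1, h, by ring⟩, hcard _ (p + q) ?_⟩
    rintro v ⟨hv, hv'⟩
    rw [mem_flipThree, neg_neg] at hv
    have h1 : v ≠ -p := by rintro rfl; exact hv' (hmem p hp)
    have h2 : v ≠ -q := by rintro rfl; exact hv' (hmem q hq)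
    simp only [Set.mem_insert_iff, Set.mem_sdiff, Set.mem_singleton_iff]
    tauto

end Lattice

/-! ### Roots in coordinates -/

section RootVectors

variable {ι : Type*} [Fintype ι] [DecidableEq ι] {S : Prop} {v : ι → ℤ}

theorem Int.eq_one_or_of_mul_self_lt {x : ℤ} (h0 : x ≠ 0) (h : x * x < 4) : x = 1 ∨ x = -1 := by
  have h1 : x < 2 := by nlinarith
  have h2 : -2 < x := by nlinarith
  omega

theorem dotProduct_self_eq_add (v : ι → ℤ) (i : ι) :
    v ⬝ᵥ v = v i * v i + (v - Pi.single i (v i)) ⬝ᵥ (v - Pi.single i (v i)) := by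
  simp [dotProduct_sub, sub_dotProduct]

theorem eq_single_of_dotProduct_self_eq_one (h : v ⬝ᵥ v = 1) :
    ∃ i σ, (σ = 1 ∨ σ = -1) ∧ v = Pi.single i σ := by
  have hv : v ≠ 0 := by rintro rfl; simp at h
  obtain ⟨i, hi⟩ := Function.ne_iff.1 hv
  have hi : v i ≠ 0 := hi
  have h1 := dotProduct_self_eq_add v i
  have h2 : 0 < v i * v i := mul_self_pos.2 hi
  by_cases h3 : v - Pi.single i (v i) = 0
  · exact ⟨i, v i, Int.eq_one_or_of_mul_self_lt hi (by rw [h3] at h1; simp at h1; omega),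
      sub_eq_zero.1 h3⟩
  · have := dotProduct_self_pos_of_ne_zero h3
    omega

theorem eq_single_add_single_of_dotProduct_self_eq_two (h : v ⬝ᵥ v = 2) :
    ∃ i j σ τ, i ≠ j ∧ (σ = 1 ∨ σ = -1) ∧ (τ = 1 ∨ τ = -1) ∧
      v = Pi.single i σ + Pi.single j τ := by
  have hv : v ≠ 0 := by rintro rfl; simp at h
  obtain ⟨i, hi⟩ := Function.ne_iff.1 hv
  have hi : v i ≠ 0 := hi
  have h1 := dotProduct_self_eq_add v i
  have h2 : 0 < v i * v i := mul_self_pos.2 hi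
  have h0 : 0 ≤ (v - Pi.single i (v i)) ⬝ᵥ (v - Pi.single i (v i)) :=
    Finset.sum_nonneg fun _ _ => mul_self_nonneg _
  have h4 := Int.eq_one_or_of_mul_self_lt hi (by omega)
  have h5 : v i * v i = 1 := by rcases h4 with h | h <;> rw [h] <;> norm_num
  obtain ⟨j, τ, hτ, hj⟩ := eq_single_of_dotProduct_self_eq_one
    (v := v - Pi.single i (v i)) (by omega)
  refine ⟨i, j, v i, τ, ?_, h4, hτ, by rw [← hj]; ring⟩
  rintro rfl
  have := congrFun hj i
  simp at this
  omega

/-- Two roots `q` and `r` that add up to the opposite of a long root. -/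
theorem IsRoot.long_add_cases {i j : ι} {σ τ : ℤ} {q r : ι → ℤ} (hij : i ≠ j)
    (hσ : σ = 1 ∨ σ = -1) (hτ : τ = 1 ∨ τ = -1) (hq : IsRoot S q) (hr : IsRoot S r)
    (h0 : Pi.single i σ + Pi.single j τ + q + r = 0) :
    ∃ i' j' σ' τ', i' ≠ j' ∧ (σ' = 1 ∨ σ' = -1) ∧ (τ' = 1 ∨ τ' = -1) ∧
      (Pi.single i σ + Pi.single j τ : ι → ℤ) = Pi.single i' σ' + Pi.single j' τ' ∧
      ((S ∧ q = Pi.single i' (-σ') ∧ r = Pi.single j' (-τ')) ∨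
      ∃ k κ, k ≠ i' ∧ k ≠ j' ∧ (κ = 1 ∨ κ = -1) ∧ q = Pi.single i' (-σ') + Pi.single k κ ∧
        r = Pi.single j' (-τ') + Pi.single k (-κ)) := by
  have hcoord : ∀ k, q k = 0 ∨ q k = 1 ∨ q k = -1 := by
    intro k
    by_cases hk : q k = 0
    · exact Or.inl hk
    · refine Or.inr (Int.eq_one_or_of_mul_self_lt hk ?_)
      have h1 := dotProduct_self_eq_add q k
      have h2 : 0 ≤ (q - Pi.single k (q k)) ⬝ᵥ (q - Pi.single k (q k)) :=
        Finset.sum_nonneg fun _ _ => mul_self_nonneg _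
      unfold IsRoot at hq
      omega
  -- Expanding the squared length of r, twice this product is r·r - q·q - 2: an even number between
  -- -3 and -1.
  have hdot : σ * q i + τ * q j = -1 := by
    have e : r = -(Pi.single i σ + Pi.single j τ + q) := by linear_combination h0
    have e2 : r ⬝ᵥ r = σ * σ + τ * τ + q ⬝ᵥ q + 2 * (σ * q i + τ * q j) := by
      rw [e]
      simp [dotProduct_add, add_dotProduct, hij, hij.symm, dotProduct_neg]
      ring
    have e3 : σ * σ = 1 := by rcases hσ with rfl | rfl <;> norm_num
    have e4 : τ * τ = 1 := by rcases hτ with rfl | rfl <;> norm_num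
    unfold IsRoot at hq hr
    omega
  have main : ∀ ⦃i j : ι⦄ ⦃σ τ : ℤ⦄, i ≠ j → (σ = 1 ∨ σ = -1) → (τ = 1 ∨ τ = -1) →
      Pi.single i σ + Pi.single j τ + q + r = 0 → q i = -σ → q j = 0 →
      ((S ∧ q = Pi.single i (-σ) ∧ r = Pi.single j (-τ)) ∨
      ∃ k κ, k ≠ i ∧ k ≠ j ∧ (κ = 1 ∨ κ = -1) ∧ q = Pi.single i (-σ) + Pi.single k κ ∧
        r = Pi.single j (-τ) + Pi.single k (-κ)) := by
    intro i j σ τ hij hσ hτ h0 hqi hqj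
    have h1 := dotProduct_self_eq_add q i
    rw [hqi] at h1
    have e3 : -σ * -σ = 1 := by rcases hσ with rfl | rfl <;> norm_num
    rcases hq with hq | ⟨hS, hq⟩
    · obtain ⟨k, κ, hκ, hk⟩ := eq_single_of_dotProduct_self_eq_one
        (v := q - Pi.single i (-σ)) (by omega)
      have hκ0 : κ ≠ 0 := by omega
      right
      refine ⟨k, κ, ?_, ?_, hκ, by rw [← hk]; ring, ?_⟩
      · rintro rfl
        have := congrFun hk k
        simp [hqi] at this
        omega
      · rintro rfl
        have := congrFun hk k
        simp [hqj, hij.symm] at this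
        omega
      · rw [Pi.single_neg] at hk ⊢
        rw [Pi.single_neg, ← hk]
        linear_combination h0
    · left
      have h3 : q - Pi.single i (-σ) = 0 := by
        by_contra h
        have := dotProduct_self_pos_of_ne_zero h
        omega
      refine ⟨hS, sub_eq_zero.1 h3, ?_⟩
      rw [Pi.single_neg] at h3 ⊢
      linear_combination h0 - h3
  have hcases : (q i = -σ ∧ q j = 0) ∨ (q j = -τ ∧ q i = 0) := by
    rcases hcoord i with h1 | h1 | h1 <;> rcases hcoord j with h2 | h2 | h2 <;>
      rcases hσ with rfl | rfl <;> rcases hτ with rfl | rfl <;> rw [h1, h2] at hdot ⊢ <;> omega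
  rcases hcases with ⟨h1, h2⟩ | ⟨h1, h2⟩
  · exact ⟨i, j, σ, τ, hij, hσ, hτ, rfl, main hij hσ hτ h0 h1 h2⟩
  · exact ⟨j, i, τ, σ, hij.symm, hτ, hσ, add_comm _ _,
      main hij.symm hτ hσ (by rw [← h0]; ring) h1 h2⟩

end RootVectors

/-! ### Signed edges as roots -/

namespace SignedEdge

variable {Φ : CoxeterType} {n : ℕ}

/-- The vector of a signed edge, with integer coordinates. -/
def root : SignedEdge Φ n → (Fin n → ℤ)
  | neg i j _ => Pi.single i 1 - Pi.single j 1
  | pos i j _ => Pi.single i 1 + Pi.single j 1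
  | half _ i => Pi.single i 1

theorem vec_eq_cast_root (e : SignedEdge Φ n) (k : Fin n) : e.vec k = (e.root k : ℝ) := by
  cases e <;> simp [vec, root, Pi.single_apply]

theorem isRoot_root (e : SignedEdge Φ n) : IsRoot (Φ = CoxeterType.B) e.root := by
  cases e with
  | neg i j h =>
    left; simp [root, h.ne, h.ne']
  | pos i j h =>
    left; simp [root, h.ne, h.ne']
  | half hΦ i =>
    right; simp [root, hΦ]

/-- The endpoints of a signed edge. -/
def ends : SignedEdge Φ n → Fin n × Fin n
  | neg i j _ => (i, j)
  | pos i j _ => (i, j)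
  | half _ i => (i, i)

theorem root_injective : Function.Injective (root : SignedEdge Φ n → (Fin n → ℤ)) := by
  intro e e' h
  have h1 := congrFun h e.ends.1
  have h2 := congrFun h e.ends.2
  have h3 := congrFun h e'.ends.1
  have h4 := congrFun h e'.ends.2
  cases e <;> cases e' <;>
    simp only [root, ends, Pi.add_apply, Pi.sub_apply, Pi.single_apply] at h1 h2 h3 h4 <;> grind

theorem root_ne_neg_root (e e' : SignedEdge Φ n) : e.root ≠ -e'.root := by
  intro h
  have h1 := congrFun h e.ends.1
  have h2 := congrFun h e.ends.2
  have h3 := congrFun h e'.ends.1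
  have h4 := congrFun h e'.ends.2
  cases e <;> cases e' <;>
    simp only [root, ends, Pi.neg_apply, Pi.add_apply, Pi.sub_apply, Pi.single_apply]
      at h1 h2 h3 h4 <;> grind

theorem root_joining (i j : Fin n) (h : i ≠ j) :
    (joining i j h : SignedEdge Φ n).root = Pi.single i 1 + Pi.single j 1 := by
  unfold joining
  split_ifs
  · rfl
  · exact add_comm _ _

theorem root_between (i j : Fin n) (h : i ≠ j) : (between i j h : SignedEdge Φ n).root =
    if j < i then Pi.single i 1 - Pi.single j 1 else Pi.single j 1 - Pi.single i 1 := by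
  unfold between
  split_ifs <;> rfl

theorem exists_root_eq_or_neg {v : Fin n → ℤ} (hv : IsRoot (Φ = CoxeterType.B) v) :
    ∃ e : SignedEdge Φ n, v = e.root ∨ v = -e.root := by
  rcases hv with hv | ⟨hΦ, hv⟩
  · obtain ⟨i, j, σ, τ, hij, hσ, hτ, rfl⟩ := eq_single_add_single_of_dotProduct_self_eq_two hv
    by_cases h : σ = τ
    · subst h
      refine ⟨joining i j hij, ?_⟩
      rw [root_joining]
      rcases hσ with rfl | rfl
      · left; rfl
      · right; simp [Pi.single_neg, add_comm]
    · refine ⟨between i j hij, ?_⟩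
      rw [root_between]
      obtain rfl : τ = -σ := by omega
      rcases hσ with rfl | rfl <;> split_ifs <;>
        simp [Pi.single_neg, sub_eq_add_neg, add_comm]
  · obtain ⟨i, σ, hσ, rfl⟩ := eq_single_of_dotProduct_self_eq_one hv
    refine ⟨half hΦ i, ?_⟩
    rcases hσ with rfl | rfl
    · left; rfl
    · right; simp [root, Pi.single_neg]

end SignedEdge

/-! ### Tournaments as half systems -/

namespace CoxeterTournament

open SignedEdge

variable {Φ : CoxeterType} {n : ℕ}

/-- The root that the game `e` contributes, up to a factor `1/2`, to the score. -/
def rootOf (T : CoxeterTournament Φ n) (e : SignedEdge Φ n) : Fin n → ℤ :=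
  if T e then e.root else -e.root

/-- The set of roots contributed by the games of a tournament. -/
def roots (T : CoxeterTournament Φ n) : Set (Fin n → ℤ) :=
  Set.range T.rootOf

variable {T T' : CoxeterTournament Φ n} {e e' : SignedEdge Φ n}

theorem rootOf_mem_roots (T : CoxeterTournament Φ n) (e : SignedEdge Φ n) :
    T.rootOf e ∈ T.roots :=
  ⟨e, rfl⟩

theorem eq_and_eq_of_rootOf_eq (h : T.rootOf e = T'.rootOf e') : e = e' ∧ T e = T' e' := by
  unfold rootOf at h
  cases h1 : T e <;> cases h2 : T' e' <;> simp only [h1, h2, if_true, Bool.false_eq_true, if_false] at h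
  · exact ⟨root_injective (neg_injective h), rfl⟩
  · exact absurd h.symm (root_ne_neg_root _ _)
  · exact absurd h (root_ne_neg_root _ _)
  · exact ⟨root_injective h, rfl⟩

theorem rootOf_injective (T : CoxeterTournament Φ n) : Function.Injective T.rootOf :=
  fun _ _ h => (eq_and_eq_of_rootOf_eq h).1

theorem rootOf_mem_roots_iff : T.rootOf e ∈ T'.roots ↔ T e = T' e := by
  constructor
  · rintro ⟨e', h⟩
    obtain ⟨rfl, h⟩ := eq_and_eq_of_rootOf_eq h
    exact h.symm
  · intro h
    exact ⟨e, by rw [rootOf, rootOf, h]⟩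

theorem roots_injective :
    Function.Injective (roots : CoxeterTournament Φ n → Set (Fin n → ℤ)) := by
  intro T T' h
  funext e
  exact rootOf_mem_roots_iff.1 (h ▸ rootOf_mem_roots T e)

theorem rootOf_eq_neg (h : T e ≠ T' e) : T'.rootOf e = -T.rootOf e := by
  unfold rootOf
  cases h1 : T e <;> cases h2 : T' e <;> simp_all

theorem isHalfSystem_roots (T : CoxeterTournament Φ n) :
    IsHalfSystem (Φ = CoxeterType.B) T.roots := by
  have hneg : ∀ e, ∃ T' : CoxeterTournament Φ n, T e ≠ T' e := fun e => ⟨fun e => !(T e), by simp⟩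
  refine ⟨?_, ?_, ?_⟩
  · rintro _ ⟨e, rfl⟩
    unfold rootOf
    split_ifs
    · exact e.isRoot_root
    · exact e.isRoot_root.neg
  · intro v hv
    obtain ⟨e, he⟩ := exists_root_eq_or_neg hv
    have h : T.rootOf e = e.root ∨ T.rootOf e = -e.root := by
      unfold rootOf; split_ifs <;> simp
    have h1 := rootOf_mem_roots T e
    rcases he with rfl | rfl <;> rcases h with h | h <;> rw [h] at h1 <;> simp [h1]
  · rintro _ ⟨e, rfl⟩ h
    obtain ⟨T', hT'⟩ := hneg e
    rw [← rootOf_eq_neg hT'] at h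
    exact hT' (rootOf_mem_roots_iff.1 h).symm

/-- The weights w_e - 1/2 are ±1/2, so the score is half of an integer vector. -/
theorem score_eq_iff : T.score = T'.score ↔ ∑ e, T.rootOf e = ∑ e, T'.rootOf e := by
  have key : ∀ (T : CoxeterTournament Φ n) (k : Fin n),
      T.score k = 1 / 2 * (((∑ e, T.rootOf e) k : ℤ) : ℝ) := by
    intro T k
    rw [score, Finset.sum_apply, Finset.sum_apply, Int.cast_sum, Finset.mul_sum]
    refine Finset.sum_congr rfl fun e _ => ?_
    rw [Pi.smul_apply, vec_eq_cast_root, smul_eq_mul, rootOf]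
    split_ifs
    · ring
    · rw [Pi.neg_apply]; push_cast; ring
  constructor
  · intro h
    funext k
    have := congrFun h k
    rw [key, key] at this
    exact_mod_cast mul_left_cancel₀ (by norm_num) this
  · intro h
    funext k
    rw [key, key, h]

theorem roots_diff_roots (T T' : CoxeterTournament Φ n) :
    T.roots \ T'.roots = T.rootOf '' {e | T e ≠ T' e} := by
  ext v
  constructor
  · rintro ⟨⟨e, rfl⟩, h⟩
    exact ⟨e, fun h' => h (rootOf_mem_roots_iff.2 h'), rfl⟩
  · rintro ⟨e, h, rfl⟩
    exact ⟨rootOf_mem_roots T e, fun h' => h (rootOf_mem_roots_iff.1 h')⟩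

/-- Games with different outcomes contribute opposite roots, so the difference of the two root sums
is twice this sum. -/
theorem finsum_roots_diff_roots (h : T.score = T'.score) :
    ∑ᶠ v ∈ T.roots \ T'.roots, v = 0 := by
  rw [roots_diff_roots, finsum_mem_image T.rootOf_injective.injOn,
    finsum_mem_eq_finite_toFinset_sum _ (Set.toFinite _)]
  rw [score_eq_iff] at h
  have h1 : ∑ e, (T.rootOf e - T'.rootOf e) = 0 := by
    rw [Finset.sum_sub_distrib, h, sub_self]
  have h2 : ∑ e, (T.rootOf e - T'.rootOf e) = ∑ e with T e ≠ T' e, (2 : ℤ) • T.rootOf e := by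
    rw [Finset.sum_filter]
    refine Finset.sum_congr rfl fun e _ => ?_
    by_cases he : T e = T' e
    · simp [he, rootOf]
    · rw [if_pos he, rootOf_eq_neg he, two_smul]; ring
  rw [h2, ← Finset.smul_sum] at h1
  have h3 := (smul_eq_zero.1 h1).resolve_left (by norm_num)
  refine Eq.trans (Finset.sum_congr ?_ fun _ _ => rfl) h3
  ext e
  simp

theorem roots_reverse (T : CoxeterTournament Φ n) (e₁ e₂ e₃ : SignedEdge Φ n) :
    (T.reverse {e₁, e₂, e₃}).roots =
      flipThree T.roots (T.rootOf e₁) (T.rootOf e₂) (T.rootOf e₃) := by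
  have h1 : ∀ e ∈ ({e₁, e₂, e₃} : Finset (SignedEdge Φ n)),
      (T.reverse {e₁, e₂, e₃}).rootOf e = -T.rootOf e := by
    intro e he
    apply rootOf_eq_neg
    rw [reverse_apply_mem T he]
    simp
  have h2 : ∀ e ∉ ({e₁, e₂, e₃} : Finset (SignedEdge Φ n)),
      (T.reverse {e₁, e₂, e₃}).rootOf e = T.rootOf e := by
    intro e he
    rw [rootOf, rootOf, CoxeterTournament.reverse, if_neg he]
  ext v
  rw [mem_flipThree]
  constructor
  · rintro ⟨e, rfl⟩
    by_cases he : e ∈ ({e₁, e₂, e₃} : Finset (SignedEdge Φ n))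
    · right
      rw [h1 e he]
      simp only [Finset.mem_insert, Finset.mem_singleton] at he
      rcases he with rfl | rfl | rfl <;> simp
    · left
      rw [h2 e he]
      simp only [Finset.mem_insert, Finset.mem_singleton, not_or] at he
      exact ⟨rootOf_mem_roots T e, fun h => he.1 (T.rootOf_injective h),
        fun h => he.2.1 (T.rootOf_injective h), fun h => he.2.2 (T.rootOf_injective h)⟩
  · rintro (⟨⟨e, rfl⟩, h3, h4, h5⟩ | rfl | rfl | rfl)
    · refine ⟨e, h2 e ?_⟩
      simp only [Finset.mem_insert, Finset.mem_singleton, not_or]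
      exact ⟨fun h => h3 (by rw [h]), fun h => h4 (by rw [h]), fun h => h5 (by rw [h])⟩
    · exact ⟨e₁, h1 _ (by simp)⟩
    · exact ⟨e₂, h1 _ (by simp)⟩
    · exact ⟨e₃, h1 _ (by simp)⟩

theorem score_reverse {e₁ e₂ e₃ : SignedEdge Φ n}
    (h : T.rootOf e₁ + T.rootOf e₂ + T.rootOf e₃ = 0) :
    (T.reverse {e₁, e₂, e₃}).score = T.score := by
  have hT : IsZeroTriple T.roots (T.rootOf e₁) (T.rootOf e₂) (T.rootOf e₃) :=
    ⟨rootOf_mem_roots _ _, rootOf_mem_roots _ _, rootOf_mem_roots _ _, h⟩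
  have hH := T.isHalfSystem_roots
  have d1 : e₁ ≠ e₂ := fun h => hH.ne_of_zeroTriple hT (by rw [h])
  have d2 : e₂ ≠ e₃ := fun h => hH.ne_of_zeroTriple hT.rotate (by rw [h])
  have d3 : e₁ ≠ e₃ := fun h => hH.ne_of_zeroTriple hT.swap (by rw [h])
  rw [score_eq_iff, ← sub_eq_zero, ← Finset.sum_sub_distrib]
  have h2 : ∀ e, (T.reverse {e₁, e₂, e₃}).rootOf e - T.rootOf e =
      if e ∈ ({e₁, e₂, e₃} : Finset (SignedEdge Φ n)) then -((2 : ℤ) • T.rootOf e) else 0 := by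
    intro e
    split_ifs with he
    · rw [rootOf_eq_neg (T := T) (by rw [reverse_apply_mem T he]; simp), two_smul]; ring
    · rw [rootOf, rootOf, CoxeterTournament.reverse, if_neg he, sub_self]
  rw [Finset.sum_congr rfl fun e _ => h2 e, Finset.sum_ite_mem, Finset.univ_inter,
    Finset.sum_insert (by simp [d1, d3]), Finset.sum_insert (by simp [d2]), Finset.sum_singleton,
    ← neg_add, ← neg_add, ← smul_add, ← smul_add, ← add_assoc, h]
  simp

/-! ### Generators as zero triples -/

variable {i j : Fin n}

theorem rootOf_of_beats {hij : i ≠ j} (h : T.Beats i j hij) :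
    T.rootOf (between i j hij) = Pi.single i 1 + Pi.single j (-1) := by
  unfold Beats at h
  rw [rootOf, h, root_between]
  by_cases h' : j < i <;> simp [h', Pi.single_neg, sub_eq_add_neg]

theorem rootOf_of_collabWon {hij : i ≠ j} (h : T.CollabWon i j hij) :
    T.rootOf (joining i j hij) = Pi.single i 1 + Pi.single j 1 := by
  unfold CollabWon at h
  simp [rootOf, h, root_joining]

theorem rootOf_of_collabLost {hij : i ≠ j} (h : T.CollabLost i j hij) :
    T.rootOf (joining i j hij) = Pi.single i (-1) + Pi.single j (-1) := by
  unfold CollabLost at h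
  simp [rootOf, h, root_joining, Pi.single_neg, add_comm]

theorem rootOf_half_of_true {hΦ : Φ = CoxeterType.B} (h : T (half hΦ i) = true) :
    T.rootOf (half hΦ i) = Pi.single i 1 := by
  simp [rootOf, h, root]

theorem rootOf_half_of_false {hΦ : Φ = CoxeterType.B} (h : T (half hΦ i) = false) :
    T.rootOf (half hΦ i) = Pi.single i (-1) := by
  simp [rootOf, h, root, Pi.single_neg]

/-- Comparison with a constant tournament having the wanted outcome identifies both the game and its
result. The same device serves the next four lemmas. -/
theorem beats_of_rootOf_eq (hij : i ≠ j) (h : T.rootOf e = Pi.single i 1 + Pi.single j (-1)) :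
    e = between i j hij ∧ T.Beats i j hij := by
  obtain ⟨he, hT⟩ := eq_and_eq_of_rootOf_eq
    (h.trans (rootOf_of_beats (T := fun _ => decide (j < i)) (hij := hij) rfl).symm)
  subst he
  exact ⟨rfl, hT⟩

theorem collabWon_of_rootOf_eq (hij : i ≠ j) (h : T.rootOf e = Pi.single i 1 + Pi.single j 1) :
    e = joining i j hij ∧ T.CollabWon i j hij := by
  obtain ⟨he, hT⟩ := eq_and_eq_of_rootOf_eq
    (h.trans (rootOf_of_collabWon (T := fun _ => true) (hij := hij) rfl).symm)
  subst he
  exact ⟨rfl, hT⟩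

theorem collabLost_of_rootOf_eq (hij : i ≠ j)
    (h : T.rootOf e = Pi.single i (-1) + Pi.single j (-1)) :
    e = joining i j hij ∧ T.CollabLost i j hij := by
  obtain ⟨he, hT⟩ := eq_and_eq_of_rootOf_eq
    (h.trans (rootOf_of_collabLost (T := fun _ => false) (hij := hij) rfl).symm)
  subst he
  exact ⟨rfl, hT⟩

theorem half_of_rootOf_eq_one (hΦ : Φ = CoxeterType.B) (h : T.rootOf e = Pi.single i 1) :
    e = half hΦ i ∧ T (half hΦ i) = true := by
  obtain ⟨he, hT⟩ := eq_and_eq_of_rootOf_eq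
    (h.trans (rootOf_half_of_true (T := fun _ => true) (hΦ := hΦ) rfl).symm)
  subst he
  exact ⟨rfl, hT⟩

theorem half_of_rootOf_eq_neg_one (hΦ : Φ = CoxeterType.B) (h : T.rootOf e = Pi.single i (-1)) :
    e = half hΦ i ∧ T (half hΦ i) = false := by
  obtain ⟨he, hT⟩ := eq_and_eq_of_rootOf_eq
    (h.trans (rootOf_half_of_false (T := fun _ => false) (hΦ := hΦ) rfl).symm)
  subst he
  exact ⟨rfl, hT⟩

/-- The games of a generator contribute roots with sum zero. -/
theorem IsGenerator.exists_sum_eq_zero {S : Finset (SignedEdge Φ n)} (h : T.IsGenerator S) :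
    ∃ e₁ e₂ e₃, S = {e₁, e₂, e₃} ∧ T.rootOf e₁ + T.rootOf e₂ + T.rootOf e₃ = 0 := by
  cases h with
  | cyclicTriangle i j k hij hjk hki h₁ h₂ h₃ =>
    refine ⟨_, _, _, rfl, ?_⟩
    rw [rootOf_of_beats h₁, rootOf_of_beats h₂, rootOf_of_beats h₃]
    simp only [Pi.single_neg]; ring
  | balancedTriangle i j k hij hjk hki h₁ h₂ h₃ =>
    refine ⟨_, _, _, rfl, ?_⟩
    rw [rootOf_of_beats h₁, rootOf_of_collabWon h₂, rootOf_of_collabLost h₃]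
    simp only [Pi.single_neg]; ring
  | neutralPairOne hΦ i j hij h₁ h₂ h₃ =>
    refine ⟨_, _, _, rfl, ?_⟩
    rw [rootOf_half_of_true h₁, rootOf_half_of_true h₂, rootOf_of_collabLost h₃]
    simp only [Pi.single_neg]; ring
  | neutralPairTwo hΦ i j hij h₁ h₂ h₃ =>
    refine ⟨_, _, _, rfl, ?_⟩
    rw [rootOf_half_of_false h₁, rootOf_half_of_false h₂, rootOf_of_collabWon h₃]
    simp only [Pi.single_neg]; ring
  | neutralPairThree hΦ i j hij h₁ h₂ h₃ =>
    refine ⟨_, _, _, rfl, ?_⟩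
    rw [rootOf_half_of_false h₁, rootOf_half_of_true h₂, rootOf_of_beats h₃]
    simp only [Pi.single_neg]; ring

theorem insert_rotate {α : Type*} [DecidableEq α] (a b c : α) :
    ({a, b, c} : Finset α) = {b, c, a} := by
  ext; simp; tauto

theorem insert_swap {α : Type*} [DecidableEq α] (a b c : α) :
    ({a, b, c} : Finset α) = {a, c, b} := by
  rw [Finset.pair_comm]

theorem isGenerator_of_cyclic {e₁ e₂ e₃ : SignedEdge Φ n} {i j k : Fin n} (hij : i ≠ j)
    (hjk : j ≠ k) (hki : k ≠ i) (h₁ : T.rootOf e₁ = Pi.single i 1 + Pi.single j (-1))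
    (h₂ : T.rootOf e₂ = Pi.single j 1 + Pi.single k (-1))
    (h₃ : T.rootOf e₃ = Pi.single k 1 + Pi.single i (-1)) : T.IsGenerator {e₁, e₂, e₃} := by
  obtain ⟨rfl, w₁⟩ := beats_of_rootOf_eq hij h₁
  obtain ⟨rfl, w₂⟩ := beats_of_rootOf_eq hjk h₂
  obtain ⟨rfl, w₃⟩ := beats_of_rootOf_eq hki h₃
  exact .cyclicTriangle i j k hij hjk hki w₁ w₂ w₃

theorem isGenerator_of_balanced {e₁ e₂ e₃ : SignedEdge Φ n} {i j k : Fin n} (hij : i ≠ j)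
    (hjk : j ≠ k) (hki : k ≠ i) (h₁ : T.rootOf e₁ = Pi.single i 1 + Pi.single j (-1))
    (h₂ : T.rootOf e₂ = Pi.single j 1 + Pi.single k 1)
    (h₃ : T.rootOf e₃ = Pi.single k (-1) + Pi.single i (-1)) : T.IsGenerator {e₁, e₂, e₃} := by
  obtain ⟨rfl, w₁⟩ := beats_of_rootOf_eq hij h₁
  obtain ⟨rfl, w₂⟩ := collabWon_of_rootOf_eq hjk h₂
  obtain ⟨rfl, w₃⟩ := collabLost_of_rootOf_eq hki h₃
  exact .balancedTriangle i j k hij hjk hki w₁ w₂ w₃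

/-- Of the eight sign patterns, the two in which every root has opposite signs give cyclic
triangles. In the other six exactly one root has opposite signs, and the triangle is balanced. -/
theorem isGenerator_of_long {e₁ e₂ e₃ : SignedEdge Φ n} {k : Fin n} {σ τ κ : ℤ} (hij : i ≠ j)
    (hki : k ≠ i) (hkj : k ≠ j) (hσ : σ = 1 ∨ σ = -1) (hτ : τ = 1 ∨ τ = -1) (hκ : κ = 1 ∨ κ = -1)
    (h₁ : T.rootOf e₁ = Pi.single i σ + Pi.single j τ)
    (h₂ : T.rootOf e₂ = Pi.single i (-σ) + Pi.single k κ)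
    (h₃ : T.rootOf e₃ = Pi.single j (-τ) + Pi.single k (-κ)) :
    T.IsGenerator {e₁, e₂, e₃} := by
  have h₁' := h₁.trans (add_comm _ _)
  have h₂' := h₂.trans (add_comm _ _)
  have h₃' := h₃.trans (add_comm _ _)
  rcases hσ with rfl | rfl <;> rcases hτ with rfl | rfl <;> rcases hκ with rfl | rfl <;>
    try simp only [neg_neg] at *
  · have := isGenerator_of_balanced hki hij hkj.symm h₂' h₁ h₃
    rwa [Finset.insert_comm] at this
  · have := isGenerator_of_balanced hkj hij.symm hki.symm h₃' h₁' h₂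
    rwa [insert_rotate] at this
  · have := isGenerator_of_cyclic hij hkj.symm hki h₁ h₃ h₂'
    rwa [insert_swap] at this
  · have := isGenerator_of_balanced hij hkj.symm hki h₁ h₃ h₂'
    rwa [insert_swap] at this
  · exact isGenerator_of_balanced hij.symm hki.symm hkj h₁' h₂ h₃'
  · exact isGenerator_of_cyclic hij.symm hki.symm hkj h₁' h₂ h₃'
  · have := isGenerator_of_balanced hkj.symm hki hij h₃ h₂' h₁
    rwa [insert_rotate, insert_rotate, insert_swap] at this
  · have := isGenerator_of_balanced hki.symm hkj hij.symm h₂ h₃' h₁'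
    rwa [insert_rotate, insert_rotate] at this

theorem isGenerator_of_short {e₁ e₂ e₃ : SignedEdge Φ n} {σ τ : ℤ} (hΦ : Φ = CoxeterType.B)
    (hij : i ≠ j) (hσ : σ = 1 ∨ σ = -1) (hτ : τ = 1 ∨ τ = -1)
    (h₁ : T.rootOf e₁ = Pi.single i σ + Pi.single j τ)
    (h₂ : T.rootOf e₂ = Pi.single i (-σ)) (h₃ : T.rootOf e₃ = Pi.single j (-τ)) :
    T.IsGenerator {e₁, e₂, e₃} := by
  rw [insert_rotate]
  rcases hσ with rfl | rfl <;> rcases hτ with rfl | rfl <;>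
    try simp only [neg_neg] at h₂ h₃
  · obtain ⟨rfl, w₁⟩ := collabWon_of_rootOf_eq hij h₁
    obtain ⟨rfl, w₂⟩ := half_of_rootOf_eq_neg_one hΦ h₂
    obtain ⟨rfl, w₃⟩ := half_of_rootOf_eq_neg_one hΦ h₃
    exact .neutralPairTwo hΦ i j hij w₂ w₃ w₁
  · obtain ⟨rfl, w₁⟩ := beats_of_rootOf_eq hij h₁
    obtain ⟨rfl, w₂⟩ := half_of_rootOf_eq_neg_one hΦ h₂
    obtain ⟨rfl, w₃⟩ := half_of_rootOf_eq_one hΦ h₃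
    exact .neutralPairThree hΦ i j hij w₂ w₃ w₁
  · obtain ⟨rfl, w₁⟩ := beats_of_rootOf_eq hij.symm (h₁.trans (add_comm _ _))
    obtain ⟨rfl, w₂⟩ := half_of_rootOf_eq_one hΦ h₂
    obtain ⟨rfl, w₃⟩ := half_of_rootOf_eq_neg_one hΦ h₃
    rw [Finset.insert_comm]
    exact .neutralPairThree hΦ j i hij.symm w₃ w₂ w₁
  · obtain ⟨rfl, w₁⟩ := collabLost_of_rootOf_eq hij h₁
    obtain ⟨rfl, w₂⟩ := half_of_rootOf_eq_one hΦ h₂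
    obtain ⟨rfl, w₃⟩ := half_of_rootOf_eq_one hΦ h₃
    exact .neutralPairOne hΦ i j hij w₂ w₃ w₁

/-- Three games whose roots have sum zero form a generator. -/
theorem isGenerator_of_sum_eq_zero {e₁ e₂ e₃ : SignedEdge Φ n}
    (h : T.rootOf e₁ + T.rootOf e₂ + T.rootOf e₃ = 0) : T.IsGenerator {e₁, e₂, e₃} := by
  have hroot : ∀ e, IsRoot (Φ = CoxeterType.B) (T.rootOf e) := fun e =>
    T.isHalfSystem_roots.isRoot (rootOf_mem_roots T e)
  have main : ∀ ⦃e₁ e₂ e₃ : SignedEdge Φ n⦄, T.rootOf e₁ + T.rootOf e₂ + T.rootOf e₃ = 0 →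
      T.rootOf e₁ ⬝ᵥ T.rootOf e₁ = 2 → T.IsGenerator {e₁, e₂, e₃} := by
    intro e₁ e₂ e₃ h h2
    obtain ⟨i, j, σ, τ, hij, hσ, hτ, h₁⟩ := eq_single_add_single_of_dotProduct_self_eq_two h2
    obtain ⟨i', j', σ', τ', hij', hσ', hτ', e, hc⟩ :=
      IsRoot.long_add_cases hij hσ hτ (hroot e₂) (hroot e₃) (h₁ ▸ h)
    rw [e] at h₁
    rcases hc with ⟨hΦ, h₂, h₃⟩ | ⟨k, κ, hki, hkj, hκ, h₂, h₃⟩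
    · exact isGenerator_of_short hΦ hij' hσ' hτ' h₁ h₂ h₃
    · exact isGenerator_of_long hij' hki hkj hσ' hτ' hκ h₁ h₂ h₃
  by_cases h1 : T.rootOf e₁ ⬝ᵥ T.rootOf e₁ = 2
  · exact main h h1
  -- Three short roots cannot sum to zero: the sum of two of them has even squared length.
  · have h2 : T.rootOf e₂ ⬝ᵥ T.rootOf e₂ = 2 ∨ T.rootOf e₃ ⬝ᵥ T.rootOf e₃ = 2 := by
      have e : T.rootOf e₃ = -(T.rootOf e₁ + T.rootOf e₂) := by linear_combination h
      have e' : T.rootOf e₃ ⬝ᵥ T.rootOf e₃ = T.rootOf e₁ ⬝ᵥ T.rootOf e₁ +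
          T.rootOf e₂ ⬝ᵥ T.rootOf e₂ + 2 * (T.rootOf e₁ ⬝ᵥ T.rootOf e₂) := by
        rw [e, neg_dotProduct_neg, dotProduct_add, add_dotProduct, add_dotProduct,
          dotProduct_comm (T.rootOf e₂) (T.rootOf e₁)]
        ring
      have r1 := hroot e₁
      have r2 := hroot e₂
      have r3 := hroot e₃
      unfold IsRoot at r1 r2 r3
      omega
    rcases h2 with h2 | h2
    · rw [insert_rotate]
      exact main (by rw [← h]; ring) h2
    · rw [insert_rotate, insert_rotate]
      exact main (by rw [← h]; ring) h2

end CoxeterTournament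

/-! ### The interchange graph as a graph of flips -/

section InterchangeGraph

variable {Φ : CoxeterType} {n : ℕ} {s : Fin n → ℝ}

open CoxeterTournament

theorem intGr_adj_iff {T₁ T₂ : Tour Φ s} : (IntGr Φ s).Adj T₁ T₂ ↔
    ∃ p q r, IsZeroTriple T₁.1.roots p q r ∧ T₂.1.roots = flipThree T₁.1.roots p q r := by
  constructor
  · rintro ⟨S, hS, h⟩
    obtain ⟨e₁, e₂, e₃, rfl, h0⟩ := hS.exists_sum_eq_zero
    exact ⟨_, _, _, ⟨rootOf_mem_roots _ _, rootOf_mem_roots _ _, rootOf_mem_roots _ _, h0⟩,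
      by rw [h, roots_reverse]⟩
  · rintro ⟨_, _, _, ⟨⟨e₁, rfl⟩, ⟨e₂, rfl⟩, ⟨e₃, rfl⟩, h0⟩, h⟩
    exact ⟨_, isGenerator_of_sum_eq_zero h0, roots_injective (by rw [h, roots_reverse])⟩

theorem exists_tour_roots_eq_flipThree {T : Tour Φ s} {p q r : Fin n → ℤ}
    (h : IsZeroTriple T.1.roots p q r) : ∃ T' : Tour Φ s,
      T'.1.roots = flipThree T.1.roots p q r := by
  obtain ⟨⟨e₁, rfl⟩, ⟨e₂, rfl⟩, ⟨e₃, rfl⟩, h0⟩ := h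
  exact ⟨⟨T.1.reverse {e₁, e₂, e₃}, (score_reverse h0).trans T.2⟩, roots_reverse _ _ _ _⟩

theorem tour_eq_of_roots_eq {T₁ T₂ : Tour Φ s} (h : T₁.1.roots = T₂.1.roots) : T₁ = T₂ :=
  Subtype.ext (roots_injective h)

theorem hasNeighborMatching_intGr (Φ : CoxeterType) {n : ℕ} (s : Fin n → ℝ) :
    HasNeighborMatching (IntGr Φ s) := by
  classical
  intro x y hxy
  obtain ⟨α, β, γ, hΔ, hY⟩ := intGr_adj_iff.1 hxy
  have hx := x.1.isHalfSystem_roots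
  -- The hypotheses on z stand inside the existential so that choice yields a total map; elsewhere
  -- the value is irrelevant.
  have key : ∀ z : Tour Φ s, ∃ w : Tour Φ s, (IntGr Φ s).Adj x z → z ≠ y →
      (IntGr Φ s).Adj y w ∧ FlipMatch x.1.roots y.1.roots z.1.roots w.1.roots := by
    intro z
    by_cases hz : (IntGr Φ s).Adj x z ∧ z ≠ y
    · obtain ⟨p, q, r, hΓ, hZ⟩ := intGr_adj_iff.1 hz.1
      obtain ⟨p', q', r', hT, hm⟩ := FlipMatch.exists_match hx hΔ hY hΓ hZ
        (fun h => hz.2 (tour_eq_of_roots_eq h))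
      obtain ⟨w, hw⟩ := exists_tour_roots_eq_flipThree hT
      rw [← hw] at hm
      exact ⟨w, fun _ _ => ⟨intGr_adj_iff.2 ⟨_, _, _, hT, hw⟩, hm⟩⟩
    · exact ⟨z, fun h1 h2 => absurd ⟨h1, h2⟩ hz⟩
  choose f hf using key
  refine ⟨f, ?_, ?_⟩
  · rintro z ⟨hz, hzy⟩ z' ⟨hz', hzy'⟩ h
    have h1 := (hf z hz hzy).2
    have h2 := (hf z' hz' hzy').2
    rw [← h] at h2
    exact tour_eq_of_roots_eq (FlipMatch.injective hx y.1.isHalfSystem_roots h1 h2)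
  · intro z hz hzy
    obtain ⟨h1, h2⟩ := hf z hz hzy
    obtain ⟨h3, p, q, r, h4, h5⟩ := h2.exists_flip hx hΔ hY
    exact ⟨h1, fun h => h3 (by rw [h]), intGr_adj_iff.2 ⟨p, q, r, h4, h5⟩⟩

/-- The flip that reduces the difference may act on either end, so the walk is extended at its start
or at its finish. -/
theorem exists_walk_length_le (x y : Tour Φ s) :
    ∃ w : (IntGr Φ s).Walk x y, w.length ≤ (x.1.roots \ y.1.roots).ncard := by
  induction hk : (x.1.roots \ y.1.roots).ncard using Nat.strong_induction_on generalizing x y with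
  | _ k ih =>
    subst hk
    have hfin : ∀ T : Tour Φ s, T.1.roots.Finite := fun T => Set.finite_range _
    by_cases hne : (x.1.roots \ y.1.roots).Nonempty
    · rcases x.1.isHalfSystem_roots.exists_closer y.1.isHalfSystem_roots (hfin x) hne
        (finsum_roots_diff_roots (x.2.trans y.2.symm)) with ⟨p, q, r, h, hlt⟩ | ⟨p, q, r, h, hlt⟩
      · obtain ⟨z, hz⟩ := exists_tour_roots_eq_flipThree h
        rw [← hz] at hlt
        obtain ⟨w, hw⟩ := ih _ hlt z y rfl
        refine ⟨.cons (intGr_adj_iff.2 ⟨_, _, _, h, hz⟩) w, ?_⟩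
        rw [SimpleGraph.Walk.length_cons]
        omega
      · obtain ⟨z, hz⟩ := exists_tour_roots_eq_flipThree h
        rw [← hz] at hlt
        obtain ⟨w, hw⟩ := ih _ hlt x z rfl
        refine ⟨w.concat (intGr_adj_iff.2 ⟨_, _, _, h, hz⟩ : (IntGr Φ s).Adj y z).symm, ?_⟩
        rw [SimpleGraph.Walk.length_concat]
        omega
    · have hxy : x = y := by
        apply Subtype.ext
        funext e
        by_contra h
        apply hne
        rw [roots_diff_roots]
        exact ⟨_, e, h, rfl⟩
      subst hxy
      exact ⟨.nil, by simp⟩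

theorem card_signedEdge_le (Φ : CoxeterType) (n : ℕ) : Fintype.card (SignedEdge Φ n) ≤ 3 * n ^ 2 := by
  have h : Function.Injective fun e : SignedEdge Φ n =>
      ((match e with | .neg _ _ _ => 0 | .pos _ _ _ => 1 | .half _ _ => 2 : Fin 3), e.ends) := by
    intro e e' h
    cases e <;> cases e' <;> simp_all [SignedEdge.ends]
  have := Fintype.card_le_of_injective _ h
  simp only [Fintype.card_prod, Fintype.card_fin] at this
  rwa [sq]

theorem ncard_roots_diff_le (T T' : CoxeterTournament Φ n) :
    (T.roots \ T'.roots).ncard ≤ 3 * n ^ 2 := by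
  refine (Set.ncard_le_ncard Set.sdiff_subset (Set.finite_range _)).trans ?_
  refine le_trans ?_ (card_signedEdge_le Φ n)
  rw [← Set.image_univ]
  exact (Set.ncard_image_le (Set.toFinite _)).trans (by rw [Set.ncard_univ, Nat.card_eq_fintype_card])

theorem intGr_adj_two_le {T₁ T₂ : Tour Φ s} (h : (IntGr Φ s).Adj T₁ T₂) : 2 ≤ n := by
  obtain ⟨S, hS, -⟩ := h
  have : ∀ i j : Fin n, i ≠ j → 2 ≤ n := by
    intro i j hij
    have := Fin.val_ne_of_ne hij
    omega
  cases hS <;> exact this _ _ ‹_›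

end InterchangeGraph

/-! ### The mixing time bound -/

theorem theorem6p1 :
    ∃ C : ℝ, 0 < C ∧ ∀ (Φ : CoxeterType) (n : ℕ) (s : Fin n → ℝ), s ∈ ScoreSet Φ n →
      ∃ d : ℕ, (IntGr Φ s).IsRegularOfDegree d ∧
        ∃ π : Tour Φ s → ℝ, IsEquilibrium (lazyWalk (IntGr Φ s)) π ∧
          ∃ t : ℕ, mixingTime (lazyWalk (IntGr Φ s)) π = (t : ℕ∞) ∧
            (t : ℝ) ≤ C * (d : ℝ) * Real.log n := by
  refine ⟨8, by norm_num, fun Φ n s hs => ?_⟩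
  obtain ⟨T, hT⟩ := hs
  have : Nonempty (Tour Φ s) := ⟨⟨T, hT⟩⟩
  obtain ⟨d, hd, π, hπ, t, ht, h0, hle⟩ := (hasNeighborMatching_intGr Φ s).mixingTime_le
    (D := 3 * n ^ 2) fun x y => by
      obtain ⟨w, hw⟩ := exists_walk_length_le x y
      exact ⟨w, hw.trans (ncard_roots_diff_le _ _)⟩
  refine ⟨d, hd, π, hπ, t, ht, ?_⟩
  rcases Nat.eq_zero_or_pos d with hd0 | hd0
  · simp [hd0, h0 hd0]
  · have hn : 2 ≤ n := by
      obtain ⟨x⟩ := this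
      rw [← hd x] at hd0
      obtain ⟨z, hz⟩ := (SimpleGraph.degree_pos_iff_exists_adj _ _).1 hd0
      exact intGr_adj_two_le hz
    have hd1 : (1 : ℝ) ≤ d := by exact_mod_cast hd0
    have hn2 : (2 : ℝ) ≤ n := by exact_mod_cast hn
    have hlog : 1 / 2 ≤ Real.log n := by
      have := Real.log_le_log (by norm_num) hn2
      linarith [Real.log_two_gt_d9]
    -- For n ≥ 2 one has 12n² ≤ n⁶, because n⁴ ≥ 16.
    have hlogD : Real.log (4 * ((3 * n ^ 2 : ℕ) : ℝ)) ≤ 6 * Real.log n := by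
      have : (6 : ℝ) * Real.log n = Real.log ((n : ℝ) ^ 6) := by
        rw [Real.log_pow]; norm_num
      rw [this]
      apply Real.log_le_log (by positivity)
      push_cast
      have h4 : (2 : ℝ) ^ 4 ≤ (n : ℝ) ^ 4 := pow_le_pow_left₀ (by norm_num) hn2 4
      nlinarith [sq_nonneg (n : ℝ)]
    have hpos : 0 ≤ (d : ℝ) * Real.log (4 * ((3 * n ^ 2 : ℕ) : ℝ)) := by
      apply mul_nonneg (by linarith)
      apply Real.log_nonneg
      push_cast
      nlinarith
    have hceil := Nat.ceil_lt_add_one hpos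
    have h6 : (d : ℝ) * Real.log (4 * ((3 * n ^ 2 : ℕ) : ℝ)) ≤ d * (6 * Real.log n) := by
      gcongr
    -- The 1 lost to the ceiling is at most 2d log n, as d ≥ 1 and log n ≥ 1/2; this gives 6 + 2 =
    -- 8.
    nlinarith
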